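/- Graphs are finite and may have loops and multiple edges; the genus of a connected graph $G=(V,E)$ is $g(G)=|E|-|V|+1$. A tropical plane curve is the set of points of $\mathbb{R}^2$ at which the minimum in a tropical (min-plus) polynomial in two variables is attained at least twice; it is dual to the regular subdivision of the Newton polygon induced by the coefficients, and it is called smooth if that subdivision is a unimodular triangulation. If the Newton polygon has at least two interior lattice points, the skeleton of a smooth tropical plane curve is the graph obtained from it by removing all rays, iteratively retracting leaves together with their edges, and then smoothing over all $2$-valent vertices. A graph is called troplanar if it is isomorphic to the skeleton of a smooth tropical plane curve. Let $G$ be a troplanar graph of genus $g\geq 5$. Then $G$ does not contain three distinct vertices $v_1,v_2,v_3$ forming a path (that is, $v_1$ is adjacent to $v_2$ and $v_2$ is adjacent to $v_3$) such that each $v_i$ is incident to an edge whose other end $w_i\neq v_i$ carries a loop. -/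

import Mathlib

/-- A tropical (Laurent) polynomial in two variables over the min-plus semiring `ℝ ∪ {∞}`:
`support` is the finite set of exponent vectors of the terms whose coefficient is not `∞`, and
`coeff u` is the coefficient of the term with exponent vector `u` (its values outside `support` are
irrelevant). As a function, the polynomial is
`w ↦ min_{u ∈ support} (coeff u + u.1 * w.1 + u.2 * w.2)`. -/
structure TropicalPoly where
  support : Finset (ℤ × ℤ)
  coeff : ℤ × ℤ → ℝ

/-- Twice the signed area of the lattice triangle `a b c`. -/
def latticeDet (a b c : ℤ × ℤ) : ℤ :=
  (b.1 - a.1) * (c.2 - a.2) - (b.2 - a.2) * (c.1 - a.1)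

namespace TropicalPoly

/-- The value at the point `w` of the term of `p` with exponent vector `u`. -/
def term (p : TropicalPoly) (u : ℤ × ℤ) (w : ℝ × ℝ) : ℝ :=
  p.coeff u + u.1 * w.1 + u.2 * w.2

/-- The exponent vectors of the terms attaining the minimum in `p` at the point `w`.
The convex hulls of these sets, as `w` ranges over the plane, are the cells of the regular
subdivision of the Newton polygon induced by the coefficients. The tropical curve of `p` consists
of the points `w` for which this set has at least two elements. -/
def minimizers (p : TropicalPoly) (w : ℝ × ℝ) : Set (ℤ × ℤ) :=
  {u | u ∈ p.support ∧ ∀ v ∈ p.support, p.term u w ≤ p.term v w}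

/-- The Newton polygon of `p`. -/
def newtonPolygon (p : TropicalPoly) : Set (ℝ × ℝ) :=
  convexHull ℝ ((fun u : ℤ × ℤ => ((u.1 : ℝ), (u.2 : ℝ))) '' (p.support : Set (ℤ × ℤ)))

/-- The genus of the Newton polygon: the number of its interior lattice points. -/
noncomputable def polygonGenus (p : TropicalPoly) : ℕ :=
  {u : ℤ × ℤ | ((u.1 : ℝ), (u.2 : ℝ)) ∈ interior p.newtonPolygon}.ncard

/-- `w` is a (finite) vertex of the tropical curve of `p`: the cell dual to it in the regular
subdivision of the Newton polygon is two-dimensional. -/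
def IsVertex (p : TropicalPoly) (w : ℝ × ℝ) : Prop :=
  ∃ a ∈ p.minimizers w, ∃ b ∈ p.minimizers w, ∃ c ∈ p.minimizers w, latticeDet a b c ≠ 0

/-- The tropical curve of `p` is smooth: every two-dimensional cell of the regular subdivision of
the Newton polygon is a lattice triangle of area `1 / 2`, so that this subdivision is a
unimodular triangulation. -/
def IsSmooth (p : TropicalPoly) : Prop :=
  ∀ w, p.IsVertex w → ∃ a b c : ℤ × ℤ, p.minimizers w = {a, b, c} ∧ |latticeDet a b c| = 1

/-- The graph formed by the finite vertices and the bounded edges of the tropical curve of `p`,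
that is, the curve with its rays removed: two vertices are joined when the
two-dimensional cells dual to them share an edge. -/
def curveGraph (p : TropicalPoly) : SimpleGraph {w : ℝ × ℝ // p.IsVertex w} where
  Adj w w' := w ≠ w' ∧ (p.minimizers w.1 ∩ p.minimizers w'.1).Nontrivial
  symm := ⟨fun _ _ h => ⟨h.1.symm, by rw [Set.inter_comm]; exact h.2⟩⟩
  loopless := ⟨fun _ h => h.1 rfl⟩

end TropicalPoly

/-- The vertices of `Γ` that survive when leaves are iteratively removed from `Γ`: those in the
largest set of vertices each of which has at least two neighbours within the set. -/
def SimpleGraph.coreSet {T : Type*} (Γ : SimpleGraph T) : Set T :=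
  ⋃₀ {S | ∀ v ∈ S, 2 ≤ (Γ.neighborSet v ∩ S).encard}

/-- What remains of `Γ` after iteratively removing leaves together with their edges. -/
def SimpleGraph.core {T : Type*} (Γ : SimpleGraph T) : SimpleGraph Γ.coreSet :=
  Γ.induce Γ.coreSet

namespace Graph

/-- The multigraph `G` is obtained from the graph `H` by smoothing over all `2`-valent
vertices: `φ` identifies the vertices of `G` with the vertices of `H` that are not `2`-valent,
every edge `e` of `G` corresponds to a chain `γ e` of edges of `H` which is run through by a
trail between the vertices corresponding to the ends of `e`, all of whose inner vertices are
`2`-valent, and every edge of `H` lies in exactly one of these chains. -/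
def IsSmoothingOf {V E T : Type*} (G : Graph V E) (H : SimpleGraph T) : Prop :=
  ∃ (φ : G.vertexSet ≃ {t : T // (H.neighborSet t).encard ≠ 2}) (γ : G.edgeSet → Set (Sym2 T)),
    (∀ (e : G.edgeSet) (x y : G.vertexSet), G.IsLink e.1 x.1 y.1 →
      ∃ p : H.Walk (φ x).1 (φ y).1, p.IsTrail ∧ ¬ p.Nil ∧
        (∀ t ∈ p.support.tail.dropLast, (H.neighborSet t).encard = 2) ∧
        γ e = {f | f ∈ p.edges}) ∧
    ∀ f ∈ H.edgeSet, ∃! e : G.edgeSet, f ∈ γ e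

/-- `G` is tropically planar (troplanar): it is (isomorphic to) the skeleton of a smooth tropical
plane curve whose Newton polygon has genus at least `2`. The skeleton is obtained
from the curve by removing all rays, iteratively retracting leaves with their edges, and then
smoothing over the `2`-valent vertices. -/
def IsTroplanar {V E : Type*} (G : Graph V E) : Prop :=
  ∃ p : TropicalPoly, p.IsSmooth ∧ 2 ≤ p.polygonGenus ∧ G.IsSmoothingOf p.curveGraph.core

/-- The genus (first Betti number) `|E| - |V| + 1` of a finite connected graph. -/
noncomputable def genus {V E : Type*} (G : Graph V E) : ℤ :=
  (G.edgeSet.ncard : ℤ) - G.vertexSet.ncard + 1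

/-- `v` is incident to a (non-loop) edge whose other end carries a loop. -/
def HasPendantLoop {V E : Type*} (G : Graph V E) (v : V) : Prop :=
  ∃ (w : V) (e l : E), w ≠ v ∧ G.IsLink e v w ∧ G.IsLoopAt l w

end Graph

/-! A smooth curve is dual to a unimodular triangulation, so its core is read off from the
triangles. Every triangle of the core has an interior lattice point of the Newton polygon as a
vertex (`exists_isInner_mem`), and around an interior point `u` the core turns through all triangles
at `u`. A chain of 2-valent triangles keeps the same interior vertex, so a loop of the skeleton is
the full star of one interior point, with all triangles but one 2-valent (`exists_isLoopCell`). The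
exceptional triangle has its other vertices `a`, `b` on the boundary. An edge leaving the loop
crosses `a b` and ends at once in the reflected triangle with interior apex `a + b - u`
(`IsLoopCell.isPendant`).

Thus each `vᵢ` is a triangle whose only interior vertex is some `uᵢ`, and the path forces the three
`uᵢ` to coincide (`center_eq`). Convexity confines the support to `a`, `b`, the open cone of such a
triangle and the opposite closed quadrant (`IsCell.quadrant`). Hence any two of three such triangles
at one point share an edge, and the three form its whole star. Their cones cover the plane, and each
contains no interior point besides the apex and the point at its loop (`IsPendant.eq_add_sub`). So
at most six triangles of the core are not 2-valent. Since valencies are at most 3, the skeleton has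
at most 9 edges and genus at most 4. -/

/-! ### Affine functions and unimodular lattice coordinates -/

/-- `g` is the restriction to the lattice of a real affine function on the plane. -/
def IsAff (g : ℤ × ℤ → ℝ) : Prop := ∃ α β κ : ℝ, ∀ q, g q = α * q.1 + β * q.2 + κ

/-- In the lattice coordinate system with origin `a` and axes through `b` and `c`, the point `q` has
the coordinates `x` and `y`. -/
def HasCoord (a b c q : ℤ × ℤ) (x y : ℤ) : Prop :=
  q.1 - a.1 = x * (b.1 - a.1) + y * (c.1 - a.1) ∧ q.2 - a.2 = x * (b.2 - a.2) + y * (c.2 - a.2)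

theorem IsAff.sub {f g : ℤ × ℤ → ℝ} (hf : IsAff f) (hg : IsAff g) : IsAff fun q => f q - g q := by
  obtain ⟨α, β, κ, hf⟩ := hf
  obtain ⟨α', β', κ', hg⟩ := hg
  exact ⟨α - α', β - β', κ - κ', fun q => by simp only [hf, hg]; ring⟩

theorem isAff_latticeDet (a b : ℤ × ℤ) (k : ℤ) :
    IsAff fun q => ((k * latticeDet a b q : ℤ) : ℝ) :=
  ⟨-k * (b.2 - a.2), k * (b.1 - a.1), k * (a.1 * (b.2 - a.2) - a.2 * (b.1 - a.1)), fun q => by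
    simp only [latticeDet]; push_cast; ring⟩

namespace HasCoord

variable {a b c q : ℤ × ℤ} {x y : ℤ}

theorem aff (h : HasCoord a b c q x y) {g : ℤ × ℤ → ℝ} (hg : IsAff g) :
    g q = g a + x * (g b - g a) + y * (g c - g a) := by
  obtain ⟨α, β, κ, hg⟩ := hg
  have h1 : (q.1 : ℝ) - a.1 = x * (b.1 - a.1) + y * (c.1 - a.1) := by exact_mod_cast h.1
  have h2 : (q.2 : ℝ) - a.2 = x * (b.2 - a.2) + y * (c.2 - a.2) := by exact_mod_cast h.2
  simp only [hg]
  linear_combination α * h1 + β * h2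

theorem swap (h : HasCoord a b c q x y) : HasCoord a c b q y x :=
  ⟨by linarith [h.1], by linarith [h.2]⟩

theorem rot (h : HasCoord a b c q x y) : HasCoord b c a q y (1 - x - y) :=
  ⟨by linear_combination h.1, by linear_combination h.2⟩

theorem eq_origin (h : HasCoord a b c q 0 0) : q = a :=
  Prod.ext (by linarith [h.1]) (by linarith [h.2])

theorem eq_left (h : HasCoord a b c q 1 0) : q = b :=
  Prod.ext (by linarith [h.1]) (by linarith [h.2])

theorem latticeDet_eq (h : HasCoord a b c q x y) : latticeDet a b q = y * latticeDet a b c := by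
  simp only [latticeDet]
  linear_combination (b.1 - a.1) * h.2 - (b.2 - a.2) * h.1

theorem unique {x' y' : ℤ} (h : HasCoord a b c q x y) (h' : HasCoord a b c q x' y')
    (hd : latticeDet a b c ≠ 0) : x = x' ∧ y = y' := by
  refine ⟨?_, ?_⟩
  · have h1 := h.swap.latticeDet_eq
    rw [h'.swap.latticeDet_eq] at h1
    have : latticeDet a c b ≠ 0 := by
      intro h0; apply hd; simp only [latticeDet] at h0 ⊢; linarith
    exact (mul_right_cancel₀ this h1).symm
  · have h1 := h.latticeDet_eq
    rw [h'.latticeDet_eq] at h1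
    exact (mul_right_cancel₀ hd h1).symm

end HasCoord

theorem hasCoord_origin (a b c : ℤ × ℤ) : HasCoord a b c a 0 0 := ⟨by ring, by ring⟩

theorem hasCoord_left (a b c : ℤ × ℤ) : HasCoord a b c b 1 0 := ⟨by ring, by ring⟩

theorem hasCoord_right (a b c : ℤ × ℤ) : HasCoord a b c c 0 1 := ⟨by ring, by ring⟩

theorem hasCoord_add_sub (a b c : ℤ × ℤ) : HasCoord a b c (b + c - a) 1 1 :=
  ⟨by simp; ring, by simp; ring⟩

theorem exists_hasCoord {a b c : ℤ × ℤ} (h : |latticeDet a b c| = 1) (q : ℤ × ℤ) :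
    ∃ x y, HasCoord a b c q x y := by
  have h2 : latticeDet a b c * latticeDet a b c = 1 := by
    rw [← abs_mul_abs_self, h]; rfl
  refine ⟨latticeDet a b c * latticeDet a q c, latticeDet a b c * latticeDet a b q, ?_, ?_⟩
  · have : q.1 - a.1 = (latticeDet a b c * latticeDet a b c) * (q.1 - a.1) := by rw [h2, one_mul]
    rw [this]; simp only [latticeDet]; ring
  · have : q.2 - a.2 = (latticeDet a b c * latticeDet a b c) * (q.2 - a.2) := by rw [h2, one_mul]
    rw [this]; simp only [latticeDet]; ring

/-! ### Interior lattice points and supporting lines of the Newton polygon -/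

namespace TropicalPoly

variable {p : TropicalPoly}

/-- `u` is an interior lattice point of the Newton polygon of `p`. -/
def IsInner (p : TropicalPoly) (u : ℤ × ℤ) : Prop :=
  ((u.1 : ℝ), (u.2 : ℝ)) ∈ interior p.newtonPolygon

theorem convex_newtonPolygon (p : TropicalPoly) : Convex ℝ p.newtonPolygon := convex_convexHull ℝ _

theorem mem_newtonPolygon {q : ℤ × ℤ} (hq : q ∈ p.support) :
    ((q.1 : ℝ), (q.2 : ℝ)) ∈ p.newtonPolygon :=
  subset_convexHull ℝ _ ⟨q, by simpa using hq, rfl⟩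

/-- Hahn–Banach separates `b` from the open interior. The weak inequality passes to the whole
polygon because a convex set with nonempty interior lies in the closure of that interior; `u` is
needed only for nonemptiness. -/
theorem exists_isAff_of_not_isInner {u b : ℤ × ℤ} (hu : p.IsInner u) (hb : ¬ p.IsInner b) :
    ∃ g, IsAff g ∧ g b = 0 ∧ (∀ q ∈ p.support, g q ≤ 0) ∧ ∀ q, p.IsInner q → g q < 0 := by
  obtain ⟨f, hf⟩ := geometric_hahn_banach_open_point p.convex_newtonPolygon.interior
    isOpen_interior hb
  have hlin : ∀ v : ℝ × ℝ, f v = f (1, 0) * v.1 + f (0, 1) * v.2 := by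
    intro v
    have : v = v.1 • ((1 : ℝ), (0 : ℝ)) + v.2 • ((0 : ℝ), (1 : ℝ)) := by ext <;> simp
    conv_lhs => rw [this]
    rw [map_add, map_smul, map_smul, smul_eq_mul, smul_eq_mul]; ring
  have hle : ∀ v ∈ p.newtonPolygon, f v ≤ f ((b.1 : ℝ), (b.2 : ℝ)) := by
    intro v hv
    have h1 : v ∈ closure (interior p.newtonPolygon) := by
      rw [p.convex_newtonPolygon.closure_interior_eq_closure_of_nonempty_interior ⟨_, hu⟩]
      exact subset_closure hv
    exact closure_minimal (fun w hw => (hf w hw).le)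
      (isClosed_le f.continuous continuous_const) h1
  refine ⟨fun q => f ((q.1 : ℝ), (q.2 : ℝ)) - f ((b.1 : ℝ), (b.2 : ℝ)),
    ⟨f (1, 0), f (0, 1), - f ((b.1 : ℝ), (b.2 : ℝ)), fun q => ?_⟩, sub_self _,
    fun q hq => sub_nonpos.2 (hle _ (mem_newtonPolygon hq)), fun q hq => sub_neg.2 (hf _ hq)⟩
  simp only [hlin ((q.1 : ℝ), (q.2 : ℝ))]; ring

/-- An affine function that attains its maximum over the polygon at an interior point is constant: a
small step along the gradient `(α, β)` stays inside. -/
theorem IsInner.exists_lt {u v : ℤ × ℤ} (hu : p.IsInner u) {g : ℤ × ℤ → ℝ} (hg : IsAff g)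
    (hv : g v ≠ g u) : ∃ q ∈ p.support, g u < g q := by
  obtain ⟨α, β, κ, hg⟩ := hg
  by_contra! hcon
  have hsub : p.newtonPolygon ⊆ {w : ℝ × ℝ | α * w.1 + β * w.2 ≤ α * u.1 + β * u.2} := by
    refine convexHull_min ?_ ?_
    · rintro _ ⟨q, hq, rfl⟩
      have := hcon q (by simpa using hq)
      rw [hg, hg] at this
      simpa using this
    · exact convex_halfSpace_le (f := fun w : ℝ × ℝ => α * w.1 + β * w.2)
        ⟨fun x y => by simp; ring, fun c x => by simp; ring⟩ _
  have hnhds : ∀ᶠ w in nhds ((u.1 : ℝ), (u.2 : ℝ)), w ∈ p.newtonPolygon :=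
    mem_interior_iff_mem_nhds.1 hu
  have hcont : Filter.Tendsto (fun ε : ℝ => ((u.1 : ℝ) + ε * α, (u.2 : ℝ) + ε * β))
      (nhdsWithin 0 (Set.Ioi 0)) (nhds ((u.1 : ℝ), (u.2 : ℝ))) := by
    have : Continuous fun ε : ℝ => ((u.1 : ℝ) + ε * α, (u.2 : ℝ) + ε * β) := by fun_prop
    have h := this.tendsto 0
    simp only [zero_mul, add_zero] at h
    exact h.mono_left nhdsWithin_le_nhds
  obtain ⟨ε, h1, h2⟩ := ((hcont.eventually hnhds).and self_mem_nhdsWithin).exists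
  have h3 := hsub h1
  simp only [Set.mem_ofPred_eq] at h3
  have h2 : 0 < ε := h2
  have h4 : ε * (α * α + β * β) ≤ 0 := by linarith
  have h5 : α * α + β * β ≤ 0 := by
    by_contra h; push Not at h
    exact absurd h4 (not_le.2 (mul_pos h2 h))
  have ha : α = 0 := by nlinarith [mul_self_nonneg α, mul_self_nonneg β]
  have hb : β = 0 := by nlinarith [mul_self_nonneg α, mul_self_nonneg β]
  exact hv (by rw [hg, hg, ha, hb]; ring)

/-! ### Cells, their supporting affine functions, and crossing an edge -/

/-- The cell dual to a vertex of the tropical curve. -/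
def cell (p : TropicalPoly) (t : {w // p.IsVertex w}) : Set (ℤ × ℤ) := p.minimizers t.1

/-- The affine function whose graph supports the lifted cell dual to `t`. -/
noncomputable def lift (p : TropicalPoly) (t : {w // p.IsVertex w}) (q : ℤ × ℤ) : ℝ :=
  p.term t.2.choose t.1 - q.1 * t.1.1 - q.2 * t.1.2

/-- The cell dual to `t` is the unimodular triangle `a b c`. -/
def IsCell (p : TropicalPoly) (t : {w // p.IsVertex w}) (a b c : ℤ × ℤ) : Prop :=
  p.cell t = {a, b, c} ∧ |latticeDet a b c| = 1

variable {t t' t'' : {w // p.IsVertex w}} {a b c q : ℤ × ℤ}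

theorem isAff_lift (t : {w // p.IsVertex w}) : IsAff (p.lift t) :=
  ⟨-t.1.1, -t.1.2, p.term t.2.choose t.1, fun q => by simp only [lift]; ring⟩

theorem lift_le (t : {w // p.IsVertex w}) (hq : q ∈ p.support) : p.lift t q ≤ p.coeff q := by
  have h := t.2.choose_spec.1.2 q hq
  simp only [lift]
  simp only [term] at h ⊢
  linarith

theorem lift_eq (h : q ∈ p.cell t) : p.lift t q = p.coeff q := by
  refine le_antisymm (lift_le t h.1) ?_
  have h := h.2 _ t.2.choose_spec.1.1
  simp only [lift]
  simp only [term] at h ⊢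
  linarith

theorem mem_cell_of_lift_eq (hq : q ∈ p.support) (h : p.lift t q = p.coeff q) : q ∈ p.cell t := by
  refine ⟨hq, fun v hv => ?_⟩
  have h1 := lift_le t hv
  simp only [lift] at h h1
  simp only [term] at h h1 ⊢
  linarith

theorem lift_lt (hq : q ∈ p.support) (h : q ∉ p.cell t) : p.lift t q < p.coeff q :=
  lt_of_le_of_ne (lift_le t hq) fun h' => h (mem_cell_of_lift_eq hq h')

namespace IsCell

theorem swap (h : p.IsCell t a b c) : p.IsCell t a c b :=
  ⟨by rw [h.1, Set.pair_comm], by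
    rw [← h.2, ← abs_neg]; congr 1; simp only [latticeDet]; ring⟩

theorem rot (h : p.IsCell t a b c) : p.IsCell t b c a :=
  ⟨by rw [h.1]; ext; simp only [Set.mem_insert_iff, Set.mem_singleton_iff]; tauto, by
    rw [← h.2]; congr 1; simp only [latticeDet]; ring⟩

theorem mem₁ (h : p.IsCell t a b c) : a ∈ p.cell t := by rw [h.1]; simp

theorem mem₂ (h : p.IsCell t a b c) : b ∈ p.cell t := h.rot.mem₁

theorem mem₃ (h : p.IsCell t a b c) : c ∈ p.cell t := h.rot.rot.mem₁

theorem supp₁ (h : p.IsCell t a b c) : a ∈ p.support := h.mem₁.1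

theorem supp₂ (h : p.IsCell t a b c) : b ∈ p.support := h.mem₂.1

theorem supp₃ (h : p.IsCell t a b c) : c ∈ p.support := h.mem₃.1

theorem eq_or (h : p.IsCell t a b c) (hq : q ∈ p.cell t) : q = a ∨ q = b ∨ q = c := by
  rw [h.1] at hq; simpa using hq

theorem det_ne (h : p.IsCell t a b c) : latticeDet a b c ≠ 0 := by
  intro h0; have := h.2; rw [h0] at this; simp at this

theorem ne (h : p.IsCell t a b c) : a ≠ b := by
  rintro rfl; exact h.det_ne (by simp [latticeDet])

theorem ne' (h : p.IsCell t a b c) : a ≠ c := h.swap.ne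

theorem coord (h : p.IsCell t a b c) (q : ℤ × ℤ) : ∃ x y, HasCoord a b c q x y :=
  exists_hasCoord h.2 q

end IsCell

theorem IsSmooth.exists_isCell (hs : p.IsSmooth) (t : {w // p.IsVertex w}) :
    ∃ a b c, p.IsCell t a b c := hs t.1 t.2

theorem IsSmooth.exists_isCell₁ (hs : p.IsSmooth) (h : a ∈ p.cell t) :
    ∃ b c, p.IsCell t a b c := by
  obtain ⟨x, y, z, hc⟩ := hs.exists_isCell t
  rcases hc.eq_or h with rfl | rfl | rfl
  exacts [⟨_, _, hc⟩, ⟨_, _, hc.rot⟩, ⟨_, _, hc.rot.rot⟩]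

theorem IsSmooth.exists_isCell₂ (hs : p.IsSmooth) (ha : a ∈ p.cell t) (hb : b ∈ p.cell t)
    (hab : a ≠ b) : ∃ c, p.IsCell t a b c := by
  obtain ⟨y, z, hc⟩ := hs.exists_isCell₁ ha
  rcases hc.eq_or hb with rfl | rfl | rfl
  exacts [absurd rfl hab, ⟨_, hc⟩, ⟨_, hc.swap⟩]

/-- Equality of the terms at three non-collinear exponents is a nonsingular linear system for the
point of the curve. -/
theorem cell_injective : Function.Injective p.cell := by
  intro t t' h
  obtain ⟨a, ha, b, hb, c, hc, hd⟩ := t.2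
  have hab := le_antisymm (ha.2 b hb.1) (hb.2 a ha.1)
  have hac := le_antisymm (ha.2 c hc.1) (hc.2 a ha.1)
  have ha' : a ∈ p.minimizers t'.1 := (h ▸ ha : a ∈ p.cell t')
  have hb' : b ∈ p.minimizers t'.1 := (h ▸ hb : b ∈ p.cell t')
  have hc' : c ∈ p.minimizers t'.1 := (h ▸ hc : c ∈ p.cell t')
  have hab' := le_antisymm (ha'.2 b hb'.1) (hb'.2 a ha'.1)
  have hac' := le_antisymm (ha'.2 c hc'.1) (hc'.2 a ha'.1)
  have hdR : ((b.1 : ℝ) - a.1) * (c.2 - a.2) - (b.2 - a.2) * (c.1 - a.1) ≠ 0 := by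
    have : ((latticeDet a b c : ℤ) : ℝ) ≠ 0 := by exact_mod_cast hd
    simpa [latticeDet] using this
  simp only [term] at hab hac hab' hac'
  apply Subtype.ext
  have e1 : (((b.1 : ℝ) - a.1) * (c.2 - a.2) - (b.2 - a.2) * (c.1 - a.1)) *
      (t.1.1 - t'.1.1) = 0 := by
    linear_combination (-(c.2 - a.2 : ℝ)) * (hab - hab') + (b.2 - a.2 : ℝ) * (hac - hac')
  have e2 : (((b.1 : ℝ) - a.1) * (c.2 - a.2) - (b.2 - a.2) * (c.1 - a.1)) *
      (t.1.2 - t'.1.2) = 0 := by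
    linear_combination ((c.1 - a.1 : ℝ)) * (hab - hab') - (b.1 - a.1 : ℝ) * (hac - hac')
  exact Prod.ext (sub_eq_zero.1 ((mul_eq_zero.1 e1).resolve_left hdR))
    (sub_eq_zero.1 ((mul_eq_zero.1 e2).resolve_left hdR))

instance finite_vertex (p : TropicalPoly) : Finite {w // p.IsVertex w} :=
  have := p.support.finite_toSet.finite_subsets.to_subtype
  Finite.of_injective
    (fun t => (⟨p.cell t, fun _ h => h.1⟩ : {s : Set (ℤ × ℤ) | s ⊆ (p.support : Set (ℤ × ℤ))}))
    fun _ _ h => cell_injective (congrArg Subtype.val h)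

theorem IsCell.eq_of_mem (h : p.IsCell t a b c) (hs : p.IsSmooth) (ha : a ∈ p.cell t')
    (hb : b ∈ p.cell t') (hc : c ∈ p.cell t') : t = t' := by
  obtain ⟨d, hd⟩ := hs.exists_isCell₂ ha hb h.ne
  rcases hd.eq_or hc with e | e | e
  · exact absurd e.symm h.ne'
  · exact absurd e.symm h.rot.ne
  · exact cell_injective (by rw [h.1, hd.1, e])

/-- Crossing the edge `a b` of a cell increases the supporting affine function beyond it. -/
theorem IsCell.lift_lt_lift (h : p.IsCell t a b c) (hs : p.IsSmooth) (ha : a ∈ p.cell t')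
    (hb : b ∈ p.cell t') (hne : t' ≠ t) {x y : ℤ} (hq : HasCoord a b c q x y) (hy : y < 0) :
    p.lift t q < p.lift t' q := by
  have h1 := hq.aff ((isAff_lift t').sub (isAff_lift t))
  have h2 : p.lift t' c < p.lift t c := by
    rw [lift_eq h.mem₃]
    exact lift_lt h.supp₃ fun hc => hne (h.eq_of_mem hs ha hb hc).symm
  simp only [lift_eq ha, lift_eq hb, lift_eq h.mem₁, lift_eq h.mem₂, sub_self] at h1
  have hy' : (y : ℝ) < 0 := by exact_mod_cast hy
  nlinarith

/-- Unimodularity leaves `y = ±1`. The difference of the two supporting functions vanishes along `a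
b` and has opposite signs at `c` and `d`, which excludes `y = 1`. -/
theorem IsCell.opposite (h : p.IsCell t a b c) (hs : p.IsSmooth) {d : ℤ × ℤ}
    (h' : p.IsCell t' a b d) (hne : t' ≠ t) :
    ∃ x, HasCoord a b c d x (-1) := by
  obtain ⟨x, y, hd⟩ := h.coord d
  have hy : |y| = 1 := by
    have h1 := hd.latticeDet_eq
    have h2 := h'.2
    rwa [h1, abs_mul, h.2, mul_one] at h2
  rcases (abs_eq (by norm_num)).1 hy with rfl | rfl
  · exfalso
    have h1 := hd.aff ((isAff_lift t').sub (isAff_lift t))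
    have h2 : p.lift t' c < p.lift t c := by
      rw [lift_eq h.mem₃]
      exact lift_lt h.supp₃ fun hc => hne (h.eq_of_mem hs h'.mem₁ h'.mem₂ hc).symm
    have h3 : p.lift t d < p.lift t' d := by
      rw [lift_eq h'.mem₃]
      exact lift_lt h'.supp₃ fun hc => hne (h'.eq_of_mem hs h.mem₁ h.mem₂ hc)
    simp only [lift_eq h'.mem₁, lift_eq h'.mem₂, lift_eq h.mem₁, lift_eq h.mem₂, sub_self] at h1
    norm_num at h1
    linarith
  · exact ⟨x, hd⟩

/-- At most one other cell contains a given edge of a cell. -/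
theorem IsCell.nbr_unique (h : p.IsCell t a b c) (hs : p.IsSmooth) (ha : a ∈ p.cell t')
    (hb : b ∈ p.cell t') (hne : t' ≠ t) (ha' : a ∈ p.cell t'') (hb' : b ∈ p.cell t'')
    (hne' : t'' ≠ t) : t' = t'' := by
  by_contra hcon
  obtain ⟨d, hd⟩ := hs.exists_isCell₂ ha hb h.ne
  obtain ⟨e, he⟩ := hs.exists_isCell₂ ha' hb' h.ne
  obtain ⟨x, hx⟩ := h.opposite hs hd hne
  obtain ⟨y, hy⟩ := h.opposite hs he hne'
  obtain ⟨z, hz⟩ := hd.opposite hs he (Ne.symm hcon)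
  -- Three third vertices would lie pairwise on opposite sides of the line `a b`.
  have h1 := hx.latticeDet_eq
  have h2 := hy.latticeDet_eq
  have h3 := hz.latticeDet_eq
  have := h.det_ne
  omega

/-- Across an edge which is not on the boundary of the Newton polygon there is another cell. -/
theorem IsCell.exists_nbr (h : p.IsCell t a b c) (hs : p.IsSmooth) (hqs : q ∈ p.support) {x y : ℤ}
    (hq : HasCoord a b c q x y) (hy : y < 0) : ∃ t' d, t' ≠ t ∧ p.IsCell t' a b d := by
  -- `Y` is the second lattice coordinate with respect to `a b c`; the sign of the determinant is
  -- absorbed by multiplying with it.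
  set Y : ℤ × ℤ → ℝ := fun v => ((latticeDet a b c * latticeDet a b v : ℤ) : ℝ) with hY
  have hdd : latticeDet a b c * latticeDet a b c = 1 := by
    rw [← abs_mul_abs_self, h.2]; rfl
  have hYq : Y q < 0 := by
    have : latticeDet a b c * latticeDet a b q = y := by
      rw [hq.latticeDet_eq]; linear_combination y * hdd
    simp only [hY, this]; exact_mod_cast hy
  have hYc : Y c = 1 := by simp only [hY, hdd]; norm_num
  have hYa : Y a = 0 := by simp [hY, latticeDet]
  have hYb : Y b = 0 := by simp [hY, latticeDet]; ring_nf; simp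
  set σ : ℤ × ℤ → ℝ := fun v => p.term v t.1 - p.term a t.1 with hσ
  have hσ0 : ∀ v ∈ p.support, 0 ≤ σ v := fun v hv => sub_nonneg.2 (h.mem₁.2 v hv)
  have hσb : σ b = 0 := sub_eq_zero.2 (le_antisymm (h.mem₂.2 a h.supp₁) (h.mem₁.2 b h.supp₂))
  -- Ratio test: moving along the dual edge, on which `a` and `b` stay tied, the first term beyond
  -- `a b` to catch up with them is the one with least slack per unit of `-Y`.
  obtain ⟨d, hd, hmin⟩ := Finset.exists_min_image (p.support.filter fun v => Y v < 0)
    (fun v => σ v / (-Y v)) ⟨q, by simp [hqs, hYq]⟩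
  rw [Finset.mem_filter] at hd
  obtain ⟨hds, hYd⟩ := hd
  set τ : ℝ := σ d / (-Y d) with hτ
  have hτ0 : 0 ≤ τ := div_nonneg (hσ0 d hds) (by linarith)
  set w : ℝ × ℝ := (t.1.1 - τ * latticeDet a b c * (b.2 - a.2),
    t.1.2 + τ * latticeDet a b c * (b.1 - a.1)) with hw
  have hterm : ∀ v, p.term v w - p.term a w = σ v + τ * Y v := by
    intro v
    simp only [hσ, hY, hw, term, latticeDet]
    push_cast
    ring
  have hnonneg : ∀ v ∈ p.support, 0 ≤ σ v + τ * Y v := by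
    intro v hv
    by_cases hv0 : Y v < 0
    · have h1 := hmin v (by simp [hv, hv0])
      rw [le_div_iff₀ (by linarith)] at h1
      linarith
    · have := mul_nonneg hτ0 (not_lt.1 hv0)
      linarith [hσ0 v hv]
  have hmem : ∀ v ∈ p.support, σ v + τ * Y v = 0 → v ∈ p.minimizers w := by
    intro v hv h0
    refine ⟨hv, fun v' hv' => ?_⟩
    have h1 := hterm v
    have h2 := hterm v'
    have h3 := hnonneg v' hv'
    linarith
  have hma : a ∈ p.minimizers w := hmem a h.supp₁ (by simp [hYa, hσ])
  have hmb : b ∈ p.minimizers w := hmem b h.supp₂ (by simp [hYb, hσb])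
  have hmd : d ∈ p.minimizers w := hmem d hds (by
    rw [hτ]; field_simp [hYd.ne]; ring)
  have hdet : latticeDet a b d ≠ 0 := by
    intro h0; simp [hY, h0] at hYd
  let t' : {w // p.IsVertex w} := ⟨w, a, hma, b, hmb, d, hmd, hdet⟩
  obtain ⟨e, he⟩ := hs.exists_isCell₂ (t := t') hma hmb h.ne
  refine ⟨t', e, fun hne => ?_, he⟩
  have hd' : d ∈ p.cell t := hne ▸ (hmd : d ∈ p.cell t')
  rcases h.eq_or hd' with e | e | e <;> rw [e] at hYd <;> linarith

/-- Since `a` is interior, the line `a b` has support points strictly on its far side. -/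
theorem IsCell.exists_nbr_of_isInner (h : p.IsCell t a b c) (hs : p.IsSmooth)
    (ha : p.IsInner a) : ∃ t' d, t' ≠ t ∧ p.IsCell t' a b d := by
  have hdd : latticeDet a b c * latticeDet a b c = 1 := by
    rw [← abs_mul_abs_self, h.2]; rfl
  obtain ⟨q, hq, hlt⟩ := ha.exists_lt (v := c) (isAff_latticeDet a b (-latticeDet a b c)) (by
    have : latticeDet a b a = 0 := by simp [latticeDet]
    rw [this, neg_mul, hdd]; norm_num)
  obtain ⟨x, y, hxy⟩ := h.coord q
  refine h.exists_nbr hs hq hxy ?_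
  rw [hxy.latticeDet_eq] at hlt
  have h0 : latticeDet a b a = 0 := by simp [latticeDet]
  rw [h0, mul_zero] at hlt
  have : -latticeDet a b c * (y * latticeDet a b c) = -y := by linear_combination (-y) * hdd
  rw [this] at hlt
  have h4 : (0 : ℤ) < -y := by exact_mod_cast hlt
  omega

end TropicalPoly

/-! ### Lattice points relative to a triangle with boundary vertices -/

namespace TropicalPoly

variable {p : TropicalPoly} {t t' t'' : {w // p.IsVertex w}} {u a b c q : ℤ × ℤ} {x y : ℤ}

/-- This is the supporting line at `a`, normalized to value `0` at `u` and `1` at `a`; `β` is its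
value at `b`, at most `1` because `b` is in the support. -/
theorem IsCell.exists_coord_bound (h : p.IsCell t u a b) (hu : p.IsInner u) (ha : ¬ p.IsInner a) :
    ∃ β : ℝ, β ≤ 1 ∧ ∀ q x y, HasCoord u a b q x y →
      (q ∈ p.support → x + β * y ≤ 1) ∧ (p.IsInner q → x + β * y < 1) := by
  obtain ⟨g, hg, hga, hle, hlt⟩ := exists_isAff_of_not_isInner hu ha
  have hk : 0 < -g u := neg_pos.2 (hlt u hu)
  refine ⟨(g b - g u) / (-g u), by rw [div_le_one hk]; linarith [hle b h.supp₃], ?_⟩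
  intro q x y hq
  have h1 : g q = (-g u) * (x + (g b - g u) / (-g u) * y - 1) := by
    have h2 : (-g u) * ((g b - g u) / (-g u)) = g b - g u := mul_div_cancel₀ _ hk.ne'
    rw [hq.aff hg, hga]; linear_combination (-(y : ℝ)) * h2
  refine ⟨fun hqs => ?_, fun hqi => ?_⟩
  · have := hle q hqs
    rw [h1] at this
    by_contra! hcon
    exact absurd this (not_le.2 (mul_pos hk (by linarith)))
  · have := hlt q hqi
    rw [h1] at this
    by_contra! hcon
    exact absurd this (not_lt.2 (mul_nonneg hk.le (by linarith)))

theorem IsCell.one_le_right (h : p.IsCell t u a b) (hu : p.IsInner u) (ha : ¬ p.IsInner a)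
    (hq : HasCoord u a b q x y) (hqs : q ∈ p.support) (hxy : 2 ≤ x + y) : 1 ≤ y := by
  obtain ⟨β, hβ, hall⟩ := h.exists_coord_bound hu ha
  by_contra! hy
  have h1 := (hall q x y hq).1 hqs
  have h2 : (y : ℝ) ≤ 0 := by exact_mod_cast (by omega : y ≤ 0)
  have h3 : (2 : ℝ) ≤ x + y := by exact_mod_cast hxy
  nlinarith

theorem IsCell.one_le_left (h : p.IsCell t u a b) (hu : p.IsInner u) (hb : ¬ p.IsInner b)
    (hq : HasCoord u a b q x y) (hqs : q ∈ p.support) (hxy : 2 ≤ x + y) : 1 ≤ x :=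
  h.swap.one_le_right hu hb hq.swap hqs (by omega)

/-- If an interior lattice point lies beyond the edge `a b` opposite to the interior lattice point
`u`, and `a`, `b` are on the boundary, then the reflection of `u` in the midpoint of that edge is
an interior lattice point. -/
theorem IsCell.isInner_add_sub (h : p.IsCell t u a b) (hu : p.IsInner u) (ha : ¬ p.IsInner a)
    (hb : ¬ p.IsInner b) (hq : HasCoord u a b q x y) (hqs : q ∈ p.support) (hqi : p.IsInner q)
    (hxy : 2 ≤ x + y) : p.IsInner (a + b - u) := by
  -- A supporting function `g` vanishing at `a + b - u` satisfies `g a - g u = -g b ≥ 0`, and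
  -- likewise for `b`. As both coordinates of `q` are at least `1`, this gives `g q ≥ 0`.
  by_contra hs
  obtain ⟨g, hg, hgs, hle, hlt⟩ := exists_isAff_of_not_isInner hu hs
  have h1 := (hasCoord_add_sub u a b).aff hg
  have h2 := hq.aff hg
  have h3 := hle a h.supp₂
  have h4 := hle b h.supp₃
  have h5 := hlt q hqi
  have hx : (1 : ℝ) ≤ x := by exact_mod_cast h.one_le_left hu hb hq hqs hxy
  have hy : (1 : ℝ) ≤ y := by exact_mod_cast h.one_le_right hu ha hq hqs hxy
  rw [hgs] at h1
  push_cast at h1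
  nlinarith

theorem IsCell.eq_add_sub (h : p.IsCell t u a b) (hu : p.IsInner u) (ha : ¬ p.IsInner a)
    (hb : ¬ p.IsInner b) (hq : HasCoord u a b q x y) (hqs : q ∈ p.support) (hxy : x + y = 2) :
    q = a + b - u := by
  have hx := h.one_le_left hu hb hq hqs hxy.ge
  have hy := h.one_le_right hu ha hq hqs hxy.ge
  obtain rfl : x = 1 := by omega
  obtain rfl : y = 1 := by omega
  have h1 := hasCoord_add_sub u a b
  exact Prod.ext (by linarith [hq.1, h1.1]) (by linarith [hq.2, h1.2])

/-- The position of the lattice points relative to a triangle `u a b` with `u` interior, `a`, `b`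
on the boundary, and `a + b - u` interior. -/
theorem IsCell.quadrant (h : p.IsCell t u a b) (hu : p.IsInner u) (ha : ¬ p.IsInner a)
    (hb : ¬ p.IsInner b) (hs : p.IsInner (a + b - u)) (hq : HasCoord u a b q x y)
    (hqs : q ∈ p.support) : (0 < x ∧ 0 < y) ∨ q = a ∨ q = b ∨ (x ≤ 0 ∧ y ≤ 0) := by
  have key : ∀ {a b : ℤ × ℤ} {x y : ℤ}, p.IsCell t u a b → ¬ p.IsInner a →
      p.IsInner (a + b - u) → HasCoord u a b q x y → 0 < x → y ≤ 0 → q = a := by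
    intro a b x y h ha hs hq hx hy
    obtain ⟨β, -, hall⟩ := h.exists_coord_bound hu ha
    -- Interiority of the point `(1, 1)` makes `β` negative, so `x + β * y ≤ 1` with `x ≥ 1`, `y ≤
    -- 0` leaves only `(1, 0)`.
    have h1 := (hall _ _ _ (hasCoord_add_sub u a b)).2 hs
    have h2 := (hall _ _ _ hq).1 hqs
    push_cast at h1
    have hx' : (1 : ℝ) ≤ x := by exact_mod_cast hx
    have hy' : (y : ℝ) ≤ 0 := by exact_mod_cast hy
    have h3 : (y : ℝ) = 0 := by nlinarith
    have h4 : (x : ℝ) = 1 := by rw [h3] at h2; linarith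
    obtain rfl : y = 0 := by exact_mod_cast h3
    obtain rfl : x = 1 := by exact_mod_cast h4
    exact hq.eq_left
  rcases lt_or_ge 0 x with hx | hx <;> rcases lt_or_ge 0 y with hy | hy
  · exact Or.inl ⟨hx, hy⟩
  · exact Or.inr (Or.inl (key h ha hs hq hx hy))
  · exact Or.inr (Or.inr (Or.inl (key h.swap hb (by rwa [add_comm b a]) hq.swap hy hx)))
  · exact Or.inr (Or.inr (Or.inr ⟨hx, hy⟩))

theorem IsCell.pos_of_isInner (h : p.IsCell t u a b) (hu : p.IsInner u) (ha : ¬ p.IsInner a)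
    (hb : ¬ p.IsInner b) (hq : HasCoord u a b q x y) (hqi : p.IsInner q) (hqu : q ≠ u)
    (hx : 0 ≤ x) (hy : 0 ≤ y) : 0 < x ∧ 0 < y := by
  have key : ∀ {a b : ℤ × ℤ} {x : ℤ}, p.IsCell t u a b → ¬ p.IsInner a →
      HasCoord u a b q x 0 → 0 ≤ x → False := by
    intro a b x h ha hq hx
    obtain ⟨β, -, hall⟩ := h.exists_coord_bound hu ha
    have h1 := (hall _ _ _ hq).2 hqi
    have h2 : (x : ℝ) < 1 := by simpa using h1
    have h3 : x < 1 := by exact_mod_cast h2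
    obtain rfl : x = 0 := by omega
    exact hqu hq.eq_origin
  refine ⟨lt_of_le_of_ne hx ?_, lt_of_le_of_ne hy ?_⟩
  · rintro rfl
    exact key h.swap hb hq.swap hy
  · rintro rfl
    exact key h ha hq hx

theorem curveGraph_adj_iff :
    p.curveGraph.Adj t t' ↔
      t ≠ t' ∧ ∃ a b, a ≠ b ∧ a ∈ p.cell t ∧ b ∈ p.cell t ∧ a ∈ p.cell t' ∧ b ∈ p.cell t' := by
  constructor
  · rintro ⟨hne, a, ha, b, hb, hab⟩
    exact ⟨hne, a, b, hab, ha.1, hb.1, ha.2, hb.2⟩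
  · rintro ⟨hne, a, b, hab, ha, hb, ha', hb'⟩
    exact ⟨hne, a, ⟨ha, ha'⟩, b, ⟨hb, hb'⟩, hab⟩

theorem IsCell.adj_cases (h : p.IsCell t a b c) (hadj : p.curveGraph.Adj t t') :
    (a ∈ p.cell t' ∧ b ∈ p.cell t') ∨ (a ∈ p.cell t' ∧ c ∈ p.cell t') ∨
      (b ∈ p.cell t' ∧ c ∈ p.cell t') := by
  obtain ⟨-, x, y, hxy, hx, hy, hx', hy'⟩ := curveGraph_adj_iff.1 hadj
  rcases h.eq_or hx with rfl | rfl | rfl <;> rcases h.eq_or hy with rfl | rfl | rfl <;> tauto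

theorem IsCell.adj (h : p.IsCell t a b c) (hne : t' ≠ t) (ha : a ∈ p.cell t')
    (hb : b ∈ p.cell t') : p.curveGraph.Adj t t' :=
  curveGraph_adj_iff.2 ⟨hne.symm, a, b, h.ne, h.mem₁, h.mem₂, ha, hb⟩

end TropicalPoly

/-! ### The core of a graph -/

namespace SimpleGraph

variable {T : Type*} {Γ : SimpleGraph T}

theorem exists_adj_of_mem_coreSet {v : T} (hv : v ∈ Γ.coreSet) :
    ∃ x ∈ Γ.coreSet, ∃ y ∈ Γ.coreSet, x ≠ y ∧ Γ.Adj v x ∧ Γ.Adj v y := by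
  obtain ⟨S, hS, hvS⟩ := hv
  have h1 : 1 < (Γ.neighborSet v ∩ S).encard := lt_of_lt_of_le (by norm_num) (hS v hvS)
  obtain ⟨x, y, hx, hy, hxy⟩ := Set.one_lt_encard_iff.1 h1
  exact ⟨x, ⟨S, hS, hx.2⟩, y, ⟨S, hS, hy.2⟩, hxy, hx.1, hy.1⟩

theorem subset_coreSet {S : Set T}
    (h : ∀ v ∈ S, ∃ x ∈ S, ∃ y ∈ S, x ≠ y ∧ Γ.Adj v x ∧ Γ.Adj v y) : S ⊆ Γ.coreSet := by
  refine Set.subset_sUnion_of_mem fun v hv => ?_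
  obtain ⟨x, hx, y, hy, hxy, hvx, hvy⟩ := h v hv
  rw [← Set.encard_pair hxy]
  refine Set.encard_le_encard ?_
  rintro z (rfl | rfl)
  exacts [⟨hvx, hx⟩, ⟨hvy, hy⟩]

end SimpleGraph

/-! ### Which cells belong to the core of the curve -/

namespace TropicalPoly

variable {p : TropicalPoly} {t t' t'' : {w // p.IsVertex w}} {u a b c d q : ℤ × ℤ} {x y : ℤ}

/-- Some other cell of the core contains both `a` and `b`. -/
def CoreAcross (p : TropicalPoly) (t : {w // p.IsVertex w}) (a b : ℤ × ℤ) : Prop :=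
  ∃ t' ∈ p.curveGraph.coreSet, t' ≠ t ∧ a ∈ p.cell t' ∧ b ∈ p.cell t'

theorem CoreAcross.symm (h : p.CoreAcross t a b) : p.CoreAcross t b a := by
  obtain ⟨t', h1, h2, h3, h4⟩ := h
  exact ⟨t', h1, h2, h4, h3⟩

/-- The cells with an interior vertex form a set as in the definition of the core: both edges at
that vertex lead to further cells containing it. -/
theorem IsSmooth.mem_coreSet (hs : p.IsSmooth) (hu : p.IsInner u) (ht : u ∈ p.cell t) :
    t ∈ p.curveGraph.coreSet := by
  refine SimpleGraph.subset_coreSet (S := {t | ∃ u, p.IsInner u ∧ u ∈ p.cell t}) ?_ ⟨u, hu, ht⟩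
  rintro t ⟨u, hu, ht⟩
  obtain ⟨a, b, h⟩ := hs.exists_isCell₁ ht
  obtain ⟨t₁, d₁, hne₁, h₁⟩ := h.exists_nbr_of_isInner hs hu
  obtain ⟨t₂, d₂, hne₂, h₂⟩ := h.swap.exists_nbr_of_isInner hs hu
  refine ⟨t₁, ⟨u, hu, h₁.mem₁⟩, t₂, ⟨u, hu, h₂.mem₁⟩, ?_, h.adj hne₁ h₁.mem₁ h₁.mem₂,
    h.swap.adj hne₂ h₂.mem₁ h₂.mem₂⟩
  rintro rfl
  exact hne₁ (h.eq_of_mem hs h₁.mem₁ h₁.mem₂ h₂.mem₂).symm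

theorem IsCell.coreAcross_of_isInner (h : p.IsCell t u a b) (hs : p.IsSmooth) (hu : p.IsInner u) :
    p.CoreAcross t u a := by
  obtain ⟨t', d, hne, h'⟩ := h.exists_nbr_of_isInner hs hu
  exact ⟨t', hs.mem_coreSet hu h'.mem₁, hne, h'.mem₁, h'.mem₂⟩

theorem IsCell.coreAcross_or (h : p.IsCell t a b c) (hs : p.IsSmooth)
    (ht : t ∈ p.curveGraph.coreSet) : p.CoreAcross t a b ∨ p.CoreAcross t a c := by
  obtain ⟨x, hx, y, hy, hxy, htx, hty⟩ := SimpleGraph.exists_adj_of_mem_coreSet ht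
  rcases h.adj_cases htx with h1 | h1 | h1
  · exact Or.inl ⟨x, hx, htx.ne', h1⟩
  · exact Or.inr ⟨x, hx, htx.ne', h1⟩
  rcases h.adj_cases hty with h2 | h2 | h2
  · exact Or.inl ⟨y, hy, hty.ne', h2⟩
  · exact Or.inr ⟨y, hy, hty.ne', h2⟩
  exact absurd (h.rot.nbr_unique hs h1.1 h1.2 htx.ne' h2.1 h2.2 hty.ne') hxy

/-- If the core of the curve extends beyond an edge `a b` of the subdivision with both ends on the
boundary, then there is an interior lattice point beyond that edge. -/
theorem IsCell.exists_isInner_beyond (hs : p.IsSmooth) (hinner : ∃ u, p.IsInner u)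
    (h : p.IsCell t a b d) (ht : t ∈ p.curveGraph.coreSet) (ha : ¬ p.IsInner a)
    (hb : ¬ p.IsInner b) (hc : p.CoreAcross t a b) :
    ∃ q ∈ p.support, p.IsInner q ∧ ∃ x y, HasCoord a b d q x y ∧ 0 < y := by
  classical
  obtain ⟨u₀, hu₀⟩ := hinner
  set B : ℤ × ℤ → ℤ × ℤ → ℤ × ℤ → Finset (ℤ × ℤ) := fun a b d =>
    p.support.filter fun q => 0 < latticeDet a b q * latticeDet a b d with hB
  have hBmem : ∀ {t : {w // p.IsVertex w}} {a b d q : ℤ × ℤ} {x y : ℤ}, p.IsCell t a b d →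
      HasCoord a b d q x y → (q ∈ B a b d ↔ q ∈ p.support ∧ 0 < y) := by
    intro t a b d q x y h hq
    have : latticeDet a b d * latticeDet a b d = 1 := by rw [← abs_mul_abs_self, h.2]; rfl
    simp only [hB, Finset.mem_filter, hq.latticeDet_eq, mul_assoc, this, mul_one]
  obtain ⟨n, hn⟩ : ∃ n, (B a b d).card = n := ⟨_, rfl⟩
  -- The induction is on the number of support points beyond the edge. From a triangle with no
  -- interior vertex the core must leave through `d a` or `d b`, and fewer support points remain
  -- beyond that edge.
  induction n using Nat.strong_induction_on generalizing t a b d with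
  | _ n ih =>
  by_cases hd : p.IsInner d
  · exact ⟨d, h.supp₃, hd, 0, 1, hasCoord_right a b d, one_pos⟩
  have step : ∀ {a b : ℤ × ℤ}, p.IsCell t a b d → ¬ p.IsInner a → ¬ p.IsInner b →
      p.CoreAcross t a b → (B a b d).card = n → p.CoreAcross t d a →
      ∃ q ∈ p.support, p.IsInner q ∧ ∃ x y, HasCoord a b d q x y ∧ 0 < y := by
    intro a b h ha hb hc hn hda
    obtain ⟨t₀, -, hne₀, ha₀, hb₀⟩ := hc
    obtain ⟨c, h₀⟩ := hs.exists_isCell₂ ha₀ hb₀ h.ne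
    obtain ⟨z, hz⟩ := h.opposite hs h₀ hne₀
    obtain ⟨t₁, ht₁, hne₁, hd₁, ha₁⟩ := hda
    obtain ⟨e, h₁⟩ := hs.exists_isCell₂ ha₁ hd₁ h.ne'
    obtain ⟨k, hk⟩ := h.swap.opposite hs h₁ hne₁
    have conv : ∀ {q : ℤ × ℤ} {x y : ℤ}, HasCoord a d e q x y →
        HasCoord a b d q (-y) (x + y * k) := fun {q x y} hq =>
      ⟨by linear_combination hq.1 + y * hk.1, by linear_combination hq.2 + y * hk.2⟩
    obtain ⟨g, hg, hga, hle, hlt⟩ := exists_isAff_of_not_isInner hu₀ ha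
    have hgb := hle b h.supp₂
    have hgd := hle d h.supp₃
    -- Beyond `d a` one stays beyond `a b`. Otherwise the supporting function at `a` vanishes at
    -- `b`; the vertex `c` across `a b` then forces it to vanish at `d`, hence identically.
    have hpos : ∀ {q : ℤ × ℤ} {x y : ℤ}, q ∈ p.support → HasCoord a b d q x y → x < 0 →
        0 < y := by
      intro q x y hqs hq hx
      by_contra! hy
      have hx' : (x : ℝ) < 0 := by exact_mod_cast hx
      have hy' : (y : ℝ) ≤ 0 := by exact_mod_cast hy
      have h1 := hq.aff hg
      have h2 := hle q hqs
      have h3 := hz.aff hg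
      have h4 := hle c h₀.supp₃
      obtain ⟨x₀, y₀, h5⟩ := h.coord u₀
      have h6 := h5.aff hg
      have h7 := hlt u₀ hu₀
      simp only [hga, zero_add, sub_zero] at h1 h3 h6
      have hb0 : g b = 0 := by nlinarith
      rw [hb0] at h3 h6
      push_cast at h3
      have hd0 : g d = 0 := by linarith
      rw [h6, hd0] at h7
      simp at h7
    have hsub : B a d e ⊂ B a b d := by
      refine Finset.ssubset_iff_subset_ne.2 ⟨fun q hq => ?_, fun heq => ?_⟩
      · obtain ⟨x, y, hxy⟩ := h₁.coord q
        obtain ⟨hqs, hy⟩ := (hBmem h₁ hxy).1 hq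
        exact (hBmem h (conv hxy)).2 ⟨hqs, hpos hqs (conv hxy) (by omega)⟩
      · have h1 := (hBmem h (hasCoord_right a b d)).2 ⟨h.supp₃, one_pos⟩
        rw [← heq, hBmem h₁ (hasCoord_left a d e)] at h1
        omega
    obtain ⟨q, hqs, hqi, x, y, hq, hy⟩ := ih _ (hn ▸ Finset.card_lt_card hsub) h₁ ht₁ ha hd
      ⟨t, ht, hne₁.symm, h.mem₁, h.mem₃⟩ rfl
    exact ⟨q, hqs, hqi, -y, _, conv hq, hpos hqs (conv hq) (by omega)⟩
  rcases h.rot.rot.coreAcross_or hs ht with hda | hdb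
  · exact step h ha hb hc hn hda
  · have hn' : (B b a d).card = n := by
      rw [← hn]; congr 1
      ext q
      obtain ⟨x, y, hxy⟩ := h.coord q
      rw [hBmem h hxy, hBmem h.rot.swap hxy.rot.swap]
    obtain ⟨q, hqs, hqi, x, y, hq, hy⟩ := step h.rot.swap hb ha hc.symm hn' hdb
    exact ⟨q, hqs, hqi, _, _, hq.rot.swap, hy⟩

theorem IsCell.beyond_of_coreAcross (h : p.IsCell t a b c) (hs : p.IsSmooth)
    (hinner : ∃ u, p.IsInner u) (ht : t ∈ p.curveGraph.coreSet) (ha : ¬ p.IsInner a)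
    (hb : ¬ p.IsInner b) (hc : p.CoreAcross t a b) :
    ∃ q ∈ p.support, p.IsInner q ∧ ∃ x y, HasCoord a b c q x y ∧ y < 0 := by
  obtain ⟨t', ht', hne, ha', hb'⟩ := hc
  obtain ⟨d, h'⟩ := hs.exists_isCell₂ ha' hb' h.ne
  obtain ⟨q, hqs, hqi, x, y, hq, hy⟩ := h'.exists_isInner_beyond hs hinner ht' ha hb
    ⟨t, ht, hne.symm, h.mem₁, h.mem₂⟩
  obtain ⟨k, hk⟩ := h.opposite hs h' hne
  exact ⟨q, hqs, hqi, x + y * k, -y, ⟨by linear_combination hq.1 + y * hk.1,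
    by linear_combination hq.2 + y * hk.2⟩, by omega⟩

/-- Every cell of the core contains an interior lattice point. -/
theorem IsSmooth.exists_isInner_mem (hs : p.IsSmooth) (hinner : ∃ u, p.IsInner u)
    (ht : t ∈ p.curveGraph.coreSet) : ∃ u, p.IsInner u ∧ u ∈ p.cell t := by
  obtain ⟨a, b, c, h⟩ := hs.exists_isCell t
  by_contra! hcon
  -- If all vertices are on the boundary, a core beyond `a b` makes the supporting function at `a`
  -- smaller at `b` than at `c`, and a core beyond `a c` gives the reverse.
  have key : ∀ {a b c : ℤ × ℤ}, p.IsCell t a b c → p.CoreAcross t a b → p.CoreAcross t a c →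
      False := by
    have half : ∀ {a b c : ℤ × ℤ} {g : ℤ × ℤ → ℝ}, p.IsCell t a b c → p.CoreAcross t a b →
        IsAff g → g a = 0 → g b ≤ 0 → g c ≤ 0 → (∀ q, p.IsInner q → g q < 0) → g b < g c := by
      intro a b c g h hab hg hga hgb hgc hlt
      have ha : ¬ p.IsInner a := fun hi => hcon a hi h.mem₁
      have hb : ¬ p.IsInner b := fun hi => hcon b hi h.mem₂
      obtain ⟨q, hqs, hqi, x, y, hq, hy⟩ := h.beyond_of_coreAcross hs hinner ht ha hb hab
      obtain ⟨f, hf, hfb, hfle, hflt⟩ := exists_isAff_of_not_isInner hinner.choose_spec hb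
      have h1 := hq.aff hg
      have h2 := hq.rot.swap.aff hf
      have h3 := hlt q hqi
      have h4 := hflt q hqi
      have h5 := hfle a h.supp₁
      have h6 := hfle c h.supp₃
      have hy' : (y : ℝ) < 0 := by exact_mod_cast hy
      simp only [hga, hfb, zero_add, sub_zero] at h1 h2
      -- The supporting function at `b` keeps `q` on the `a` side of the line `b c`.
      have h7 : 0 < 1 - x - y := by
        by_contra! hle
        have : ((1 - x - y : ℤ) : ℝ) ≤ 0 := by exact_mod_cast hle
        nlinarith
      have h8 : (x : ℝ) + y ≤ 0 := by exact_mod_cast (by omega : x + y ≤ 0)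
      nlinarith
    intro a b c h hab hac
    have ha : ¬ p.IsInner a := fun hi => hcon a hi h.mem₁
    obtain ⟨g, hg, hga, hle, hlt⟩ := exists_isAff_of_not_isInner hinner.choose_spec ha
    have h1 := half h hab hg hga (hle b h.supp₂) (hle c h.supp₃) hlt
    have h2 := half h.swap hac hg hga (hle c h.supp₃) (hle b h.supp₂) hlt
    linarith
  by_cases hab : p.CoreAcross t a b
  · rcases h.rot.rot.coreAcross_or hs ht with h1 | h1
    · exact key h hab h1.symm
    · exact key h.rot h1.symm hab.symm
  · have hac := (h.coreAcross_or hs ht).resolve_left hab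
    have hbc := (h.rot.coreAcross_or hs ht).resolve_right fun h' => hab h'.symm
    exact key h.rot.rot hac.symm hbc.symm

/-- The core extends across an edge `a b` with both ends on the boundary exactly by the reflection
of the cell in the midpoint of that edge. -/
theorem IsCell.isCell_of_coreAcross (h : p.IsCell t u a b) (hs : p.IsSmooth) (hu : p.IsInner u)
    (ha : ¬ p.IsInner a) (hb : ¬ p.IsInner b) (hne : t' ≠ t)
    (ht' : t' ∈ p.curveGraph.coreSet) (ha' : a ∈ p.cell t') (hb' : b ∈ p.cell t') :
    p.IsInner (a + b - u) ∧ p.IsCell t' (a + b - u) a b := by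
  obtain ⟨q, hqs, hqi, x, y, hq, hy⟩ := h.rot.beyond_of_coreAcross hs ⟨u, hu⟩
    (hs.mem_coreSet hu h.mem₁) ha hb ⟨t', ht', hne, ha', hb'⟩
  have hs' := h.isInner_add_sub hu ha hb hq.rot.rot hqs hqi (by omega)
  obtain ⟨d, h'⟩ := hs.exists_isCell₂ ha' hb' h.rot.ne
  obtain ⟨k, hk⟩ := h.rot.opposite hs h' hne
  have hd := h.eq_add_sub hu ha hb hk.rot.rot h'.supp₃ (by ring)
  rw [← hd]
  exact ⟨hd ▸ hs', h'.rot.rot⟩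

/-- The neighbour across `a b` must have third vertex `a + b - u`, which is interior, and so it lies
in the core. -/
theorem IsCell.coreAcross_of_beyond (h : p.IsCell t u a b) (hs : p.IsSmooth) (hu : p.IsInner u)
    (ha : ¬ p.IsInner a) (hb : ¬ p.IsInner b) (hq : HasCoord u a b q x y) (hqs : q ∈ p.support)
    (hqi : p.IsInner q) (hxy : 2 ≤ x + y) : p.CoreAcross t a b := by
  have hs' := h.isInner_add_sub hu ha hb hq hqs hqi hxy
  obtain ⟨t', d, hne, h'⟩ := h.rot.exists_nbr hs hqs hq.rot (by omega)
  obtain ⟨k, hk⟩ := h.rot.opposite hs h' hne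
  have hd := h.eq_add_sub hu ha hb hk.rot.rot h'.supp₃ (by ring)
  exact ⟨t', hs.mem_coreSet (hd ▸ hs') h'.mem₃, hne, h'.mem₁, h'.mem₂⟩

end TropicalPoly

/-! ### Stars of interior points and bridge triangles -/

namespace TropicalPoly

variable {p : TropicalPoly} {t t' t'' t₁ t₂ t₃ : {w // p.IsVertex w}}
  {u a b c d q : ℤ × ℤ} {x y : ℤ}

/-- Evaluated at `q`, the difference of the two supporting functions is nonnegative by one cone and
nonpositive by the other, hence zero. Positive `x` and `y` then put `a` and `b` into the second cell
as well. -/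
theorem IsCell.not_overlap (h : p.IsCell t u a b) (h' : p.IsCell t' u c d) (hs : p.IsSmooth)
    (hne : t ≠ t') (hq : HasCoord u a b q x y) (hx : 0 < x) (hy : 0 < y) {x' y' : ℤ}
    (hq' : HasCoord u c d q x' y') (hx' : 0 ≤ x') (hy' : 0 ≤ y') : False := by
  have h1 := hq.aff ((isAff_lift t).sub (isAff_lift t'))
  have h2 := hq'.aff ((isAff_lift t).sub (isAff_lift t'))
  simp only [lift_eq h.mem₁, lift_eq h'.mem₁, lift_eq h.mem₂, lift_eq h.mem₃, lift_eq h'.mem₂,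
    lift_eq h'.mem₃, sub_self, zero_add, sub_zero] at h1 h2
  have ha := lift_le t' h.supp₂
  have hb := lift_le t' h.supp₃
  have hc := lift_le t h'.supp₂
  have hd := lift_le t h'.supp₃
  have hxR : (0 : ℝ) < x := by exact_mod_cast hx
  have hyR : (0 : ℝ) < y := by exact_mod_cast hy
  have hxR' : (0 : ℝ) ≤ x' := by exact_mod_cast hx'
  have hyR' : (0 : ℝ) ≤ y' := by exact_mod_cast hy'
  have e1 := mul_nonneg hxR.le (sub_nonneg.2 ha)
  have e2 := mul_nonneg hyR.le (sub_nonneg.2 hb)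
  have e3 := mul_nonpos_of_nonneg_of_nonpos hxR' (sub_nonpos.2 hc)
  have e4 := mul_nonpos_of_nonneg_of_nonpos hyR' (sub_nonpos.2 hd)
  have f1 : (x : ℝ) * (p.coeff a - p.lift t' a) = 0 := by linarith
  have f2 : (y : ℝ) * (p.coeff b - p.lift t' b) = 0 := by linarith
  have g1 := (mul_eq_zero.1 f1).resolve_left hxR.ne'
  have g2 := (mul_eq_zero.1 f2).resolve_left hyR.ne'
  exact hne (h.eq_of_mem hs h'.mem₁ (mem_cell_of_lift_eq h.supp₂ (by linarith))
    (mem_cell_of_lift_eq h.supp₃ (by linarith)))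

theorem IsCell.mem_or_mem_of_adj (h : p.IsCell t u a b) (hadj : p.curveGraph.Adj t t') :
    a ∈ p.cell t' ∨ b ∈ p.cell t' := by
  rcases h.adj_cases hadj with h1 | h1 | h1
  exacts [Or.inl h1.2, Or.inr h1.2, Or.inl h1.1]

/-- Among two neighbours of `t` at `u`, one is the neighbour `t'` at `u`. -/
theorem IsSmooth.eq_or_eq_of_adj (hs : p.IsSmooth) (ht : u ∈ p.cell t) (h₁ : u ∈ p.cell t₁)
    (h₂ : u ∈ p.cell t₂) (h₃ : u ∈ p.cell t₃) (hne : t₁ ≠ t₂) (hadj₁ : p.curveGraph.Adj t t₁)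
    (hadj₂ : p.curveGraph.Adj t t₂) (hadj₃ : p.curveGraph.Adj t t₃) : t₃ = t₁ ∨ t₃ = t₂ := by
  obtain ⟨a, b, h⟩ := hs.exists_isCell₁ ht
  have ha : ∀ {t' t''}, u ∈ p.cell t' → u ∈ p.cell t'' → p.curveGraph.Adj t t' →
      p.curveGraph.Adj t t'' → a ∈ p.cell t' → a ∈ p.cell t'' → t' = t'' :=
    fun m m' e e' k k' => h.nbr_unique hs m k e.ne' m' k' e'.ne'
  have hb : ∀ {t' t''}, u ∈ p.cell t' → u ∈ p.cell t'' → p.curveGraph.Adj t t' →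
      p.curveGraph.Adj t t'' → b ∈ p.cell t' → b ∈ p.cell t'' → t' = t'' :=
    fun m m' e e' k k' => h.swap.nbr_unique hs m k e.ne' m' k' e'.ne'
  rcases h.mem_or_mem_of_adj hadj₁ with k1 | k1 <;>
  rcases h.mem_or_mem_of_adj hadj₂ with k2 | k2 <;>
  rcases h.mem_or_mem_of_adj hadj₃ with k3 | k3
  · exact absurd (ha h₁ h₂ hadj₁ hadj₂ k1 k2) hne
  · exact absurd (ha h₁ h₂ hadj₁ hadj₂ k1 k2) hne
  · exact Or.inl (ha h₃ h₁ hadj₃ hadj₁ k3 k1)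
  · exact Or.inr (hb h₃ h₂ hadj₃ hadj₂ k3 k2)
  · exact Or.inr (ha h₃ h₂ hadj₃ hadj₂ k3 k2)
  · exact Or.inl (hb h₃ h₁ hadj₃ hadj₁ k3 k1)
  · exact absurd (hb h₁ h₂ hadj₁ hadj₂ k1 k2) hne
  · exact absurd (hb h₁ h₂ hadj₁ hadj₂ k1 k2) hne

/-- A set of cells containing `u` which, with every cell, contains two of its neighbours. -/
structure IsStar (p : TropicalPoly) (u : ℤ × ℤ) (L : Set {w // p.IsVertex w}) : Prop where
  nonempty : L.Nonempty
  mem : ∀ t ∈ L, u ∈ p.cell t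
  nbrs : ∀ t ∈ L, ∃ t₁ ∈ L, ∃ t₂ ∈ L, t₁ ≠ t₂ ∧ p.curveGraph.Adj t t₁ ∧ p.curveGraph.Adj t t₂

namespace IsStar

variable {L : Set {w // p.IsVertex w}}

theorem mem_of_adj (hL : p.IsStar u L) (hs : p.IsSmooth) (ht : t ∈ L)
    (hadj : p.curveGraph.Adj t t') (hu : u ∈ p.cell t') : t' ∈ L := by
  obtain ⟨t₁, h₁, t₂, h₂, hne, hadj₁, hadj₂⟩ := hL.nbrs t ht
  rcases hs.eq_or_eq_of_adj (hL.mem t ht) (hL.mem _ h₁) (hL.mem _ h₂) hu hne hadj₁ hadj₂ hadj with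
    rfl | rfl
  exacts [h₁, h₂]

/-- The cones of a star at an interior lattice point cover the plane. -/
theorem exists_cone (hL : p.IsStar u L) (hs : p.IsSmooth) (hu : p.IsInner u) (q : ℤ × ℤ) :
    ∃ t ∈ L, ∃ a b x y, p.IsCell t u a b ∧ HasCoord u a b q x y ∧ 0 ≤ x ∧ 0 ≤ y := by
  -- The required cell maximizes the supporting function at `q`: crossing an edge at `u` that has
  -- `q` beyond it would increase this value.
  obtain ⟨t, ht, hmax⟩ := L.exists_max_image (fun t => p.lift t q) L.toFinite hL.nonempty
  obtain ⟨a, b, h⟩ := hs.exists_isCell₁ (hL.mem t ht)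
  have key : ∀ {a b : ℤ × ℤ} {x y : ℤ}, p.IsCell t u a b → HasCoord u a b q x y → 0 ≤ y := by
    intro a b x y h hq
    by_contra! hy
    obtain ⟨t', d, hne, h'⟩ := h.exists_nbr_of_isInner hs hu
    have hlt := h.lift_lt_lift hs h'.mem₁ h'.mem₂ hne hq hy
    exact absurd (hmax t' (hL.mem_of_adj hs ht (h.adj hne h'.mem₁ h'.mem₂) h'.mem₁))
      (not_le.2 hlt)
  obtain ⟨x, y, hq⟩ := h.coord q
  exact ⟨t, ht, a, b, x, y, h, hq, key h.swap hq.swap, key h hq⟩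

/-- The cones of the star already cover the plane, so a further cell at `u` would overlap one of
them. -/
theorem mem_of_mem_cell (hL : p.IsStar u L) (hs : p.IsSmooth) (hu : p.IsInner u)
    (ht : u ∈ p.cell t) : t ∈ L := by
  obtain ⟨a, b, h⟩ := hs.exists_isCell₁ ht
  obtain ⟨t', ht', c, d, x, y, h', hq, hx, hy⟩ := hL.exists_cone hs hu (a + b - u)
  by_contra hcon
  exact h.not_overlap h' hs (fun e => hcon (e ▸ ht')) (hasCoord_add_sub u a b) one_pos one_pos
    hq hx hy

end IsStar

/-- A triangle `u a b` of the subdivision with `u` interior, `a` and `b` on the boundary, and the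
reflection of `u` in the midpoint of `a b` interior. -/
structure IsBridge (p : TropicalPoly) (t : {w // p.IsVertex w}) (u a b : ℤ × ℤ) : Prop where
  isCell : p.IsCell t u a b
  inner : p.IsInner u
  left : ¬ p.IsInner a
  right : ¬ p.IsInner b
  refl : p.IsInner (a + b - u)

namespace IsBridge

theorem quadrant (h : p.IsBridge t u a b) (hq : HasCoord u a b q x y) (hqs : q ∈ p.support) :
    (0 < x ∧ 0 < y) ∨ q = a ∨ q = b ∨ (x ≤ 0 ∧ y ≤ 0) :=
  h.isCell.quadrant h.inner h.left h.right h.refl hq hqs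

theorem nonpos (h : p.IsBridge t u a b) (hs : p.IsSmooth) (h' : p.IsCell t' u c d) (hne : t ≠ t')
    (hq : HasCoord u a b q x y) (hqs : q ∈ p.support) (ha : q ≠ a) (hb : q ≠ b) {x' y' : ℤ}
    (hq' : HasCoord u c d q x' y') (hx' : 0 ≤ x') (hy' : 0 ≤ y') : x ≤ 0 ∧ y ≤ 0 := by
  rcases h.quadrant hq hqs with h1 | h1 | h1 | h1
  exacts [(h.isCell.not_overlap h' hs hne hq h1.1 h1.2 hq' hx' hy').elim, absurd h1 ha,
    absurd h1 hb, h1]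

/-- If there are three such triangles at `u`, then any two of them share an edge. -/
theorem adj (h₁ : p.IsBridge t₁ u a b) (h₂ : p.IsBridge t₂ u c d) {e f : ℤ × ℤ}
    (h₃ : p.IsBridge t₃ u e f) (hs : p.IsSmooth) (hsupp : e + f - u ∈ p.support)
    (h₁₂ : t₁ ≠ t₂) (h₁₃ : t₁ ≠ t₃) (h₂₃ : t₂ ≠ t₃) : p.curveGraph.Adj t₁ t₂ := by
  by_cases hca : c = a
  · exact h₁.isCell.adj h₁₂.symm h₂.isCell.mem₁ (hca ▸ h₂.isCell.mem₂)
  by_cases hcb : c = b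
  · exact h₁.isCell.swap.adj h₁₂.symm h₂.isCell.mem₁ (hcb ▸ h₂.isCell.mem₂)
  by_cases hda : d = a
  · exact h₁.isCell.adj h₁₂.symm h₂.isCell.mem₁ (hda ▸ h₂.isCell.mem₃)
  by_cases hdb : d = b
  · exact h₁.isCell.swap.adj h₁₂.symm h₂.isCell.mem₁ (hdb ▸ h₂.isCell.mem₃)
  exfalso
  have hs₃ := hasCoord_add_sub u e f
  obtain ⟨x, y, hc⟩ := h₁.isCell.coord c
  obtain ⟨z, w, hd⟩ := h₁.isCell.coord d
  obtain ⟨k, l, hk⟩ := h₁.isCell.coord (e + f - u)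
  obtain ⟨m, n, hm⟩ := h₂.isCell.coord (e + f - u)
  have hne : ∀ {v}, ¬ p.IsInner v → e + f - u ≠ v := fun hv he => hv (he ▸ h₃.refl)
  have c0 := h₁.nonpos hs h₂.isCell h₁₂ hc h₂.isCell.supp₂ hca hcb (hasCoord_left u c d)
    zero_le_one le_rfl
  have d0 := h₁.nonpos hs h₂.isCell h₁₂ hd h₂.isCell.supp₃ hda hdb (hasCoord_right u c d)
    le_rfl zero_le_one
  have k0 := h₁.nonpos hs h₃.isCell h₁₃ hk hsupp (hne h₁.left) (hne h₁.right) hs₃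
    zero_le_one zero_le_one
  have m0 := h₂.nonpos hs h₃.isCell h₂₃ hm hsupp (hne h₂.left) (hne h₂.right) hs₃
    zero_le_one zero_le_one
  -- Without a common vertex, `c` and `d` lie in the quadrant opposite to `a b`, and the third
  -- reflected point lies opposite to both pairs. Composing the coordinates reverses its signs, so
  -- that point would be `u`.
  have hm' : HasCoord u a b (e + f - u) (m * x + n * z) (m * y + n * w) :=
    ⟨by linear_combination hm.1 + m * hc.1 + n * hd.1,
      by linear_combination hm.2 + m * hc.2 + n * hd.2⟩
  obtain ⟨e1, e2⟩ := hk.unique hm' h₁.isCell.det_ne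
  have e3 : 0 ≤ m * x + n * z :=
    add_nonneg (mul_nonneg_of_nonpos_of_nonpos m0.1 c0.1) (mul_nonneg_of_nonpos_of_nonpos m0.2 d0.1)
  have e4 : 0 ≤ m * y + n * w :=
    add_nonneg (mul_nonneg_of_nonpos_of_nonpos m0.1 c0.2) (mul_nonneg_of_nonpos_of_nonpos m0.2 d0.2)
  obtain rfl : k = 0 := by linarith [k0.1]
  obtain rfl : l = 0 := by linarith [k0.2]
  have := hs₃.unique (q := e + f - u) (by rw [hk.eq_origin]; exact hasCoord_origin u e f)
    h₃.isCell.det_ne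
  omega

end IsBridge

/-- Three bridge triangles at `u` are all triangles at `u`. -/
theorem IsSmooth.isStar_of_isBridge (hs : p.IsSmooth) {a₁ b₁ a₂ b₂ a₃ b₃ : ℤ × ℤ}
    (h₁ : p.IsBridge t₁ u a₁ b₁) (h₂ : p.IsBridge t₂ u a₂ b₂) (h₃ : p.IsBridge t₃ u a₃ b₃)
    (hs₁ : a₁ + b₁ - u ∈ p.support) (hs₂ : a₂ + b₂ - u ∈ p.support)
    (hs₃ : a₃ + b₃ - u ∈ p.support)
    (h₁₂ : t₁ ≠ t₂) (h₁₃ : t₁ ≠ t₃) (h₂₃ : t₂ ≠ t₃) : p.IsStar u {t₁, t₂, t₃} := by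
  have k₁₂ := h₁.adj h₂ h₃ hs hs₃ h₁₂ h₁₃ h₂₃
  have k₁₃ := h₁.adj h₃ h₂ hs hs₂ h₁₃ h₁₂ h₂₃.symm
  have k₂₃ := h₂.adj h₃ h₁ hs hs₁ h₂₃ h₁₂.symm h₁₃.symm
  refine ⟨⟨t₁, by simp⟩, ?_, ?_⟩
  · rintro t (rfl | rfl | rfl)
    exacts [h₁.isCell.mem₁, h₂.isCell.mem₁, h₃.isCell.mem₁]
  · rintro t (rfl | rfl | rfl)
    exacts [⟨_, by simp, _, by simp, h₂₃, k₁₂, k₁₃⟩, ⟨_, by simp, _, by simp, h₁₃, k₁₂.symm, k₂₃⟩,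
      ⟨_, by simp, _, by simp, h₁₂, k₁₃.symm, k₂₃.symm⟩]

/-! ### Valency in the core and chains of 2-valent cells -/

section Core

variable {τ τ' : p.curveGraph.coreSet}

theorem IsCell.encard_ne_two (h : p.IsCell τ.1 a b c) (hs : p.IsSmooth)
    (hab : p.CoreAcross τ.1 a b) (hac : p.CoreAcross τ.1 a c) (hbc : p.CoreAcross τ.1 b c) :
    (p.curveGraph.core.neighborSet τ).encard ≠ 2 := by
  obtain ⟨t₁, m₁, n₁, x₁, y₁⟩ := hab
  obtain ⟨t₂, m₂, n₂, x₂, y₂⟩ := hac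
  obtain ⟨t₃, m₃, n₃, x₃, y₃⟩ := hbc
  intro h2
  obtain ⟨σ, σ', hne, hset⟩ := Set.encard_eq_two.1 h2
  have k₁ : (⟨t₁, m₁⟩ : p.curveGraph.coreSet) ∈ p.curveGraph.core.neighborSet τ :=
    h.adj n₁ x₁ y₁
  have k₂ : (⟨t₂, m₂⟩ : p.curveGraph.coreSet) ∈ p.curveGraph.core.neighborSet τ :=
    h.swap.adj n₂ x₂ y₂
  have k₃ : (⟨t₃, m₃⟩ : p.curveGraph.coreSet) ∈ p.curveGraph.core.neighborSet τ :=
    h.rot.adj n₃ x₃ y₃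
  have e₁₂ : t₁ ≠ t₂ := by rintro rfl; exact n₁ (h.eq_of_mem hs x₁ y₁ y₂).symm
  have e₁₃ : t₁ ≠ t₃ := by rintro rfl; exact n₁ (h.eq_of_mem hs x₁ y₁ y₃).symm
  have e₂₃ : t₂ ≠ t₃ := by rintro rfl; exact n₂ (h.eq_of_mem hs x₂ x₃ y₂).symm
  rw [hset] at k₁ k₂ k₃
  simp only [Set.mem_insert_iff, Set.mem_singleton_iff] at k₁ k₂ k₃
  rcases k₁ with rfl | rfl <;> rcases k₂ with k₂ | k₂ <;> rcases k₃ with k₃ | k₃ <;>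
    simp_all [Subtype.ext_iff]

/-- The two edges at `u` always continue in the core, so nothing may continue across `a b`; an
interior `a` or `b` would make it continue. -/
theorem IsCell.of_encard_eq_two (h : p.IsCell τ.1 u a b) (hs : p.IsSmooth) (hu : p.IsInner u)
    (h2 : (p.curveGraph.core.neighborSet τ).encard = 2) :
    ¬ p.IsInner a ∧ ¬ p.IsInner b ∧ ¬ p.CoreAcross τ.1 a b := by
  have h1 : ¬ p.CoreAcross τ.1 a b := fun hab => h.encard_ne_two hs (h.coreAcross_of_isInner hs hu)
    (h.swap.coreAcross_of_isInner hs hu) hab h2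
  exact ⟨fun ha => h1 (h.rot.coreAcross_of_isInner hs ha),
    fun hb => h1 (h.rot.rot.swap.coreAcross_of_isInner hs hb).symm, h1⟩

theorem mem_cell_of_adj (hs : p.IsSmooth) (hu : p.IsInner u) (hτ : u ∈ p.cell τ.1)
    (h2 : (p.curveGraph.core.neighborSet τ).encard = 2) (hadj : p.curveGraph.core.Adj τ τ') :
    u ∈ p.cell τ'.1 := by
  obtain ⟨a, b, h⟩ := hs.exists_isCell₁ hτ
  rcases h.adj_cases (t' := τ'.1) hadj with h1 | h1 | h1
  · exact h1.1
  · exact h1.1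
  · exact absurd ⟨τ'.1, τ'.2, fun e => hadj.ne (Subtype.ext e.symm), h1.1, h1.2⟩
      (h.of_encard_eq_two hs hu h2).2.2

theorem mem_cell_of_walk (hs : p.IsSmooth) (hu : p.IsInner u) (P : p.curveGraph.core.Walk τ τ')
    (hP : ∀ σ ∈ P.support.dropLast, (p.curveGraph.core.neighborSet σ).encard = 2)
    (hτ : u ∈ p.cell τ.1) : ∀ σ ∈ P.support, u ∈ p.cell σ.1 := by
  induction P with
  | nil => intro σ hσ; simp only [SimpleGraph.Walk.support_nil, List.mem_singleton] at hσ; rwa [hσ]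
  | cons hadj P ih =>
    rw [SimpleGraph.Walk.support_cons, List.dropLast_cons_of_ne_nil P.support_ne_nil] at hP
    intro σ hσ
    rw [SimpleGraph.Walk.support_cons, List.mem_cons] at hσ
    rcases hσ with rfl | hσ
    · exact hτ
    · exact ih (fun σ hσ => hP σ (List.mem_cons_of_mem _ hσ))
        (mem_cell_of_adj hs hu hτ (hP _ List.mem_cons_self) hadj) σ hσ

end Core

end TropicalPoly

/-! ### Edges of trails -/

namespace SimpleGraph.Walk

variable {T : Type*} {H : SimpleGraph T} {v w x : T}

/-- A closed trail uses an even number of edges at every vertex. -/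
theorem IsTrail.exists_two_edges {P : H.Walk v v} (hP : P.IsTrail) (hnil : ¬ P.Nil)
    (hx : x ∈ P.support) : ∃ y z, y ≠ z ∧ s(x, y) ∈ P.edges ∧ s(x, z) ∈ P.edges := by
  classical
  have heven := (hP.even_countP_edges_iff x).2 fun h => absurd rfl h
  obtain ⟨e, he, hxe⟩ := (mem_support_iff_exists_mem_edges_of_not_nil hnil).1 hx
  have hpos : 0 < P.edges.countP fun e => x ∈ e := List.countP_pos_iff.2 ⟨e, he, by simpa using hxe⟩
  have h2 : 2 ≤ (P.edges.filter fun e => x ∈ e).length := by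
    rw [← List.countP_eq_length_filter]
    obtain ⟨k, hk⟩ := heven
    omega
  have hnd := hP.edges_nodup.filter fun e => decide (x ∈ e)
  obtain ⟨e₁, e₂, l, hl⟩ : ∃ e₁ e₂ l, (P.edges.filter fun e => x ∈ e) = e₁ :: e₂ :: l := by
    rcases hl : P.edges.filter fun e => x ∈ e with _ | ⟨e₁, _ | ⟨e₂, l⟩⟩
    · simp [hl] at h2
    · simp [hl] at h2
    · exact ⟨e₁, e₂, l, hl⟩
  have m₁ : e₁ ∈ P.edges.filter fun e => x ∈ e := by rw [hl]; simp
  have m₂ : e₂ ∈ P.edges.filter fun e => x ∈ e := by rw [hl]; simp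
  simp only [List.mem_filter, decide_eq_true_eq] at m₁ m₂
  obtain ⟨m₁, y, rfl⟩ := m₁
  obtain ⟨m₂, z, rfl⟩ := m₂
  refine ⟨y, z, ?_, m₁, m₂⟩
  rintro rfl
  rw [hl] at hnd
  simp at hnd

end SimpleGraph.Walk

namespace SimpleGraph.Walk

variable {T : Type*} {H : SimpleGraph T} {v w x : T}

theorem start_mem_support_dropLast {P : H.Walk v w} (h : ¬ P.Nil) : v ∈ P.support.dropLast := by
  cases P with
  | nil => exact absurd Nil.nil h
  | cons hadj P =>
    rw [support_cons, List.dropLast_cons_of_ne_nil P.support_ne_nil]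
    exact List.mem_cons_self

theorem mem_dropLast_or_eq {P : H.Walk v w} (hx : x ∈ P.support) :
    x ∈ P.support.dropLast ∨ x = w := by
  rw [← List.dropLast_append_getLast P.support_ne_nil, List.mem_append, getLast_support] at hx
  simpa using hx

/-- The two end edges of a trail, taken with their directions away from the ends, differ. -/
theorem IsTrail.exists_end_darts {P : H.Walk v w} (hP : P.IsTrail) (hnil : ¬ P.Nil) :
    ∃ σ σ', s(v, σ) ∈ P.edges ∧ s(w, σ') ∈ P.edges ∧ ¬ (v = w ∧ σ = σ') := by
  by_cases h : v = w
  · subst h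
    obtain ⟨σ, σ', hne, h1, h2⟩ := hP.exists_two_edges hnil P.start_mem_support
    exact ⟨σ, σ', h1, h2, fun h => hne h.2⟩
  · obtain ⟨e, he, σ, rfl⟩ := (mem_support_iff_exists_mem_edges_of_not_nil hnil).1
      P.start_mem_support
    obtain ⟨e', he', σ', rfl⟩ := (mem_support_iff_exists_mem_edges_of_not_nil hnil).1
      P.end_mem_support
    exact ⟨σ, σ', he, he', fun h' => h h'.1⟩

end SimpleGraph.Walk

/-! ### Loops and the pendant edges leading to them -/

namespace TropicalPoly

variable {p : TropicalPoly} {τ τ' σ τ₁ τ₂ τ₃ σ₁ σ₂ σ₃ : p.curveGraph.coreSet}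
  {u a b c d q u₁ u₂ u₃ a₁ b₁ a₂ b₂ a₃ b₃ : ℤ × ℤ} {x y : ℤ}

/-- A triangle `u a b` with `u` interior and `a`, `b` on the boundary, such that all other triangles
at `u` are `2`-valent in the core. -/
structure IsLoopCell (τ : p.curveGraph.coreSet) (u a b : ℤ × ℤ) : Prop where
  isCell : p.IsCell τ.1 u a b
  inner : p.IsInner u
  left : ¬ p.IsInner a
  right : ¬ p.IsInner b
  isStar : ∃ L, p.IsStar u L
  star : ∀ σ : p.curveGraph.coreSet, u ∈ p.cell σ.1 →
    σ = τ ∨ (p.curveGraph.core.neighborSet σ).encard = 2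

/-- The closed trail turns around a single interior point, so its cells form a star and exhaust the
cells there. The clause on edges later shows that another edge of the skeleton cannot leave `τ`
around `u`. -/
theorem exists_isLoopCell (hs : p.IsSmooth) (hinner : ∃ u, p.IsInner u)
    {P : p.curveGraph.core.Walk τ τ} (hP : P.IsTrail) (hnil : ¬ P.Nil)
    (h2 : ∀ σ ∈ P.support.tail.dropLast, (p.curveGraph.core.neighborSet σ).encard = 2) :
    ∃ u a b, IsLoopCell τ u a b ∧
      ∀ σ, p.curveGraph.core.Adj τ σ → u ∈ p.cell σ.1 → s(τ, σ) ∈ P.edges := by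
  obtain ⟨u, hu, hsupp⟩ : ∃ u, p.IsInner u ∧ ∀ σ ∈ P.support, u ∈ p.cell σ.1 := by
    cases P with
    | nil => exact absurd SimpleGraph.Walk.Nil.nil hnil
    | @cons _ ρ _ hadj P =>
      rw [SimpleGraph.Walk.support_cons, List.tail_cons] at h2
      -- The point is taken at the second cell, since `τ` need not be 2-valent; it reaches `τ` as
      -- the end of the walk.
      obtain ⟨u, hu, hρ⟩ := hs.exists_isInner_mem hinner ρ.2
      have hall := mem_cell_of_walk hs hu P h2 hρ
      refine ⟨u, hu, fun σ hσ => ?_⟩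
      rw [SimpleGraph.Walk.support_cons, List.mem_cons] at hσ
      rcases hσ with rfl | hσ
      exacts [hall _ P.end_mem_support, hall _ hσ]
  have hL : p.IsStar u (Subtype.val '' {σ | σ ∈ P.support}) := by
    refine ⟨⟨τ.1, τ, P.start_mem_support, rfl⟩, ?_, ?_⟩
    · rintro _ ⟨σ, hσ, rfl⟩
      exact hsupp σ hσ
    · rintro _ ⟨σ, hσ, rfl⟩
      obtain ⟨y, z, hyz, hy, hz⟩ := hP.exists_two_edges hnil hσ
      exact ⟨y, ⟨y, P.snd_mem_support_of_mem_edges hy, rfl⟩, z,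
        ⟨z, P.snd_mem_support_of_mem_edges hz, rfl⟩, fun e => hyz (Subtype.ext e),
        P.adj_of_mem_edges hy, P.adj_of_mem_edges hz⟩
  have hstar : ∀ σ : p.curveGraph.coreSet, u ∈ p.cell σ.1 →
      σ = τ ∨ (p.curveGraph.core.neighborSet σ).encard = 2 := by
    intro σ hσ
    obtain ⟨σ', hσ', e⟩ := hL.mem_of_mem_cell hs hu hσ
    obtain rfl := Subtype.ext e
    cases P with
    | nil => exact absurd SimpleGraph.Walk.Nil.nil hnil
    | cons hadj P =>
      rw [SimpleGraph.Walk.support_cons, List.tail_cons] at h2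
      rw [Set.mem_ofPred_eq, SimpleGraph.Walk.support_cons, List.mem_cons] at hσ'
      rcases hσ' with h | h
      · exact Or.inl h
      · rcases SimpleGraph.Walk.mem_dropLast_or_eq h with h | h
        exacts [Or.inr (h2 _ h), Or.inl h]
  obtain ⟨a, b, h⟩ := hs.exists_isCell₁ (hsupp τ P.start_mem_support)
  have key : ∀ {a b : ℤ × ℤ}, p.IsCell τ.1 u a b → ¬ p.IsInner a := by
    intro a b h
    obtain ⟨t', d, hne, h'⟩ := h.exists_nbr_of_isInner hs hu
    have hcell : p.IsCell (⟨t', hs.mem_coreSet hu h'.mem₁⟩ : p.curveGraph.coreSet).1 u a d := h'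
    exact (hcell.of_encard_eq_two hs hu ((hstar _ h'.mem₁).resolve_left
      fun e => hne (congrArg Subtype.val e))).1
  refine ⟨u, a, b, ⟨h, hu, key h, key h.swap, ⟨_, hL⟩, hstar⟩, fun σ hadj hσ => ?_⟩
  obtain ⟨y, z, hyz, hy, hz⟩ := hP.exists_two_edges hnil P.start_mem_support
  rcases hs.eq_or_eq_of_adj h.mem₁ (hsupp y (P.snd_mem_support_of_mem_edges hy))
    (hsupp z (P.snd_mem_support_of_mem_edges hz)) hσ (fun e => hyz (Subtype.ext e))
    (P.adj_of_mem_edges hy) (P.adj_of_mem_edges hz) hadj with e | e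
  · rwa [Subtype.ext e]
  · rwa [Subtype.ext e]

/-- The triangle `τ` is separated by its edge `a b` from the triangle `σ` at a loop. -/
structure IsPendant (τ σ : p.curveGraph.coreSet) (u a b : ℤ × ℤ) : Prop where
  bridge : p.IsBridge τ.1 u a b
  loop : IsLoopCell σ (a + b - u) a b

/-- The first step avoids `u`, hence crosses `a b` into the reflected triangle. There the core
continues across all three edges, so the chain stops after one step. -/
theorem IsLoopCell.isPendant (h : IsLoopCell σ u a b) (hs : p.IsSmooth)
    {P : p.curveGraph.core.Walk σ τ} (hnil : ¬ P.Nil)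
    (h2 : ∀ σ ∈ P.support.tail.dropLast, (p.curveGraph.core.neighborSet σ).encard = 2)
    (hedge : ∀ ρ, p.curveGraph.core.Adj σ ρ → u ∈ p.cell ρ.1 → s(σ, ρ) ∉ P.edges) :
    IsPendant τ σ (a + b - u) a b := by
  have hrefl : a + b - (a + b - u) = u := by abel
  cases P with
  | nil => exact absurd SimpleGraph.Walk.Nil.nil hnil
  | @cons _ ρ _ hadj P =>
    rw [SimpleGraph.Walk.support_cons, List.tail_cons] at h2
    have hρu : u ∉ p.cell ρ.1 := fun hu => hedge ρ hadj hu (by simp)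
    have hne : ρ.1 ≠ σ.1 := fun e => hadj.ne (Subtype.ext e.symm)
    obtain ⟨ha, hb⟩ : a ∈ p.cell ρ.1 ∧ b ∈ p.cell ρ.1 := by
      rcases h.isCell.adj_cases (t' := ρ.1) hadj with h1 | h1 | h1
      exacts [absurd h1.1 hρu, absurd h1.1 hρu, h1]
    obtain ⟨hi, hcell⟩ := h.isCell.isCell_of_coreAcross hs h.inner h.left h.right hne ρ.2 ha hb
    have hρ : (p.curveGraph.core.neighborSet ρ).encard ≠ 2 :=
      hcell.encard_ne_two hs (hcell.coreAcross_of_isInner hs hi)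
        (hcell.swap.coreAcross_of_isInner hs hi)
        ⟨σ.1, σ.2, hne.symm, h.isCell.mem₂, h.isCell.mem₃⟩
    have hPnil : P.Nil := by
      by_contra hcon
      exact hρ (h2 ρ (SimpleGraph.Walk.start_mem_support_dropLast hcon))
    obtain rfl := hPnil.eq
    exact ⟨⟨hcell, hi, h.left, h.right, by rw [hrefl]; exact h.inner⟩, by rw [hrefl]; exact h⟩

namespace IsPendant

theorem ne (h : IsPendant τ σ u a b) : σ ≠ τ := by
  rintro rfl
  have h1 := h.loop.isCell.mem₁
  rcases h.bridge.isCell.eq_or h1 with e | e | e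
  · have := (hasCoord_add_sub u a b).unique (by rw [e]; exact hasCoord_origin u a b)
      h.bridge.isCell.det_ne
    omega
  · exact h.bridge.left (e ▸ h.bridge.refl)
  · exact h.bridge.right (e ▸ h.bridge.refl)

/-- An edge leaving `τ` either turns around `u` up to its end or crosses `a b` into `σ`, where it
stops. -/
theorem mem_or_eq (h : IsPendant τ σ u a b) (hs : p.IsSmooth)
    (hσ : (p.curveGraph.core.neighborSet σ).encard ≠ 2) {P : p.curveGraph.core.Walk τ τ'}
    (hnil : ¬ P.Nil)
    (h2 : ∀ σ ∈ P.support.tail.dropLast, (p.curveGraph.core.neighborSet σ).encard = 2) :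
    u ∈ p.cell τ'.1 ∨ τ' = σ := by
  cases P with
  | nil => exact absurd SimpleGraph.Walk.Nil.nil hnil
  | @cons _ ρ _ hadj P =>
    rw [SimpleGraph.Walk.support_cons, List.tail_cons] at h2
    have hu : u ∈ p.cell ρ.1 → u ∈ p.cell τ'.1 := fun hu =>
      mem_cell_of_walk hs h.bridge.inner P h2 hu _ P.end_mem_support
    rcases h.bridge.isCell.adj_cases (t' := ρ.1) hadj with h1 | h1 | h1
    · exact Or.inl (hu h1.1)
    · exact Or.inl (hu h1.1)
    · have e : ρ = σ := Subtype.ext (h.bridge.isCell.rot.nbr_unique hs h1.1 h1.2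
        (fun e => hadj.ne (Subtype.ext e.symm)) h.loop.isCell.mem₂ h.loop.isCell.mem₃
        (fun e => h.ne (Subtype.ext e)))
      subst e
      have hPnil : P.Nil := by
        by_contra hcon
        exact hσ (h2 _ (SimpleGraph.Walk.start_mem_support_dropLast hcon))
      exact Or.inr hPnil.eq.symm

theorem eq_of_mem (h : IsPendant τ σ u a b) (hq : p.IsInner q) (hmem : q ∈ p.cell τ.1) :
    q = u := by
  rcases h.bridge.isCell.eq_or hmem with e | e | e
  exacts [e, absurd (e ▸ hq) h.bridge.left, absurd (e ▸ hq) h.bridge.right]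

theorem eq_of_mem_loop (h : IsPendant τ σ u a b) (hq : p.IsInner q) (hmem : q ∈ p.cell σ.1) :
    q = a + b - u := by
  rcases h.loop.isCell.eq_or hmem with e | e | e
  exacts [e, absurd (e ▸ hq) h.bridge.left, absurd (e ▸ hq) h.bridge.right]

theorem center_eq (h₁ : IsPendant τ₁ σ₁ u₁ a₁ b₁) (h₂ : IsPendant τ₂ σ₂ u₂ a₂ b₂)
    (hs : p.IsSmooth) (h₁₂ : u₂ ∈ p.cell τ₁.1 ∨ τ₁ = σ₂) (h₃₂ : u₂ ∈ p.cell τ₃.1 ∨ τ₃ = σ₂)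
    (h2 : (p.curveGraph.core.neighborSet τ₃).encard ≠ 2) (hne₁ : τ₃ ≠ τ₁) (hne₂ : τ₃ ≠ τ₂) :
    u₂ = u₁ := by
  rcases h₁₂ with h | rfl
  · exact h₁.eq_of_mem h₂.bridge.inner h
  exfalso
  -- If `τ₁` carried the loop at `τ₂`, then `σ₁ = τ₂` because only one cell lies across that edge.
  -- Then `u₂` is the point at a loop, and `τ₃` would be `τ₁`, `τ₂` or 2-valent.
  have hu : a₂ + b₂ - u₂ = u₁ := h₁.eq_of_mem h₂.bridge.refl h₂.loop.isCell.mem₁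
  have key : ∀ {v}, ¬ p.IsInner v → v ∈ p.cell τ₁.1 → v ∈ p.cell σ₁.1 := by
    intro v hv hmem
    rcases h₁.bridge.isCell.eq_or hmem with e | e | e
    · exact absurd (e ▸ h₁.bridge.inner) hv
    · rw [e]; exact h₁.loop.isCell.mem₂
    · rw [e]; exact h₁.loop.isCell.mem₃
  have e : σ₁.1 = τ₂.1 := h₂.loop.isCell.rot.nbr_unique hs
    (key h₂.bridge.left h₂.loop.isCell.mem₂) (key h₂.bridge.right h₂.loop.isCell.mem₃)
    (fun e => h₁.ne (Subtype.ext e)) h₂.bridge.isCell.mem₂ h₂.bridge.isCell.mem₃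
    (fun e => h₂.ne (Subtype.ext e.symm))
  have hu₂ : u₂ = a₁ + b₁ - u₁ :=
    h₁.eq_of_mem_loop h₂.bridge.inner (e ▸ h₂.bridge.isCell.mem₁)
  rcases h₃₂ with h | h
  · rcases h₁.loop.star τ₃ (hu₂ ▸ h) with h | h
    · exact hne₂ (h.trans (Subtype.ext e))
    · exact h2 h
  · exact hne₁ h

/-- An interior lattice point in the cone of a pendant triangle is the interior lattice point at
the loop. -/
theorem eq_add_sub (h : IsPendant τ σ u a b) (hs : p.IsSmooth) (hq : HasCoord u a b q x y)
    (hqs : q ∈ p.support) (hqi : p.IsInner q) (hqu : q ≠ u) (hx : 0 ≤ x) (hy : 0 ≤ y) :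
    q = a + b - u := by
  by_contra hcon
  obtain ⟨hx, hy⟩ := h.bridge.isCell.pos_of_isInner h.bridge.inner h.bridge.left h.bridge.right
    hq hqi hqu hx hy
  obtain ⟨L, hL⟩ := h.loop.isStar
  obtain ⟨t, ht, c, d, z, w, hc, hz, hz0, hw0⟩ := hL.exists_cone hs h.loop.inner q
  have hcore := hs.mem_coreSet h.loop.inner hc.mem₁
  rcases h.loop.star ⟨t, hcore⟩ hc.mem₁ with e | e
  · have key : ∀ {z w : ℤ}, HasCoord (a + b - u) a b q z w → 0 ≤ z → 0 ≤ w → False := by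
      intro z w hz hz0 hw0
      have h1 : HasCoord u a b q (1 - w) (1 - z) := by
        obtain ⟨e1, e2⟩ := hz
        simp only [Prod.fst_add, Prod.fst_sub, Prod.snd_add, Prod.snd_sub] at e1 e2
        exact ⟨by linear_combination e1, by linear_combination e2⟩
      obtain ⟨e1, e2⟩ := hq.unique h1 h.bridge.isCell.det_ne
      obtain rfl : z = 0 := by omega
      obtain rfl : w = 0 := by omega
      exact hcon hz.eq_origin
    obtain rfl : t = σ.1 := congrArg Subtype.val e
    rcases h.loop.isCell.eq_or hc.mem₂ with e1 | e1 | e1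
    · exact hc.ne e1.symm
    · have e2 : d = b := by
        rcases h.loop.isCell.eq_or hc.mem₃ with e2 | e2 | e2
        exacts [absurd e2.symm hc.ne', absurd (e1.trans e2.symm) hc.rot.ne, e2]
      rw [e1, e2] at hz
      exact key hz hz0 hw0
    · have e2 : d = a := by
        rcases h.loop.isCell.eq_or hc.mem₃ with e2 | e2 | e2
        exacts [absurd e2.symm hc.ne', e2, absurd (e1.trans e2.symm) hc.rot.ne]
      rw [e1, e2] at hz
      exact key hz.swap hw0 hz0
  · obtain ⟨hc1, hd1, hcd⟩ := IsCell.of_encard_eq_two (τ := ⟨t, hcore⟩) hc hs h.loop.inner e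
    have hzw := hc.pos_of_isInner h.loop.inner hc1 hd1 hz hqi hcon hz0 hw0
    exact hcd (hc.coreAcross_of_beyond hs h.loop.inner hc1 hd1 hz hqs hqi (by omega))

/-- If there are three pendant triangles at `u`, then they and the triangles at the loops are all
the triangles that are not `2`-valent in the core. -/
theorem eq_of_encard_ne_two (h₁ : IsPendant τ₁ σ₁ u a₁ b₁) (h₂ : IsPendant τ₂ σ₂ u a₂ b₂)
    (h₃ : IsPendant τ₃ σ₃ u a₃ b₃) (hs : p.IsSmooth) (h₁₂ : τ₁ ≠ τ₂) (h₁₃ : τ₁ ≠ τ₃)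
    (h₂₃ : τ₂ ≠ τ₃) (h2 : (p.curveGraph.core.neighborSet τ).encard ≠ 2) :
    τ ∈ ({τ₁, τ₂, τ₃, σ₁, σ₂, σ₃} : Set p.curveGraph.coreSet) := by
  have hval : ∀ {τ τ' : p.curveGraph.coreSet}, τ ≠ τ' → τ.1 ≠ τ'.1 := fun h e => h (Subtype.ext e)
  have hL := hs.isStar_of_isBridge h₁.bridge h₂.bridge h₃.bridge h₁.loop.isCell.supp₁
    h₂.loop.isCell.supp₁ h₃.loop.isCell.supp₁ (hval h₁₂) (hval h₁₃) (hval h₂₃)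
  obtain ⟨q, hqi, hq⟩ := hs.exists_isInner_mem ⟨u, h₁.bridge.inner⟩ τ.2
  simp only [Set.mem_insert_iff, Set.mem_singleton_iff]
  by_cases hqu : q = u
  · rcases hL.mem_of_mem_cell hs h₁.bridge.inner (hqu ▸ hq) with e | e | e
    exacts [Or.inl (Subtype.ext e), Or.inr (Or.inl (Subtype.ext e)),
      Or.inr (Or.inr (Or.inl (Subtype.ext e)))]
  have key : ∀ {τ' σ : p.curveGraph.coreSet} {a b c d : ℤ × ℤ} {x y : ℤ},
      IsPendant τ' σ u a b → p.IsCell τ'.1 u c d → HasCoord u c d q x y → 0 ≤ x → 0 ≤ y →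
      τ = σ := by
    intro τ' σ a b c d x y h hc hxy hx hy
    have hq' : q = a + b - u := by
      rcases h.bridge.isCell.eq_or hc.mem₂ with e1 | e1 | e1
      · exact absurd e1.symm hc.ne
      · have e2 : d = b := by
          rcases h.bridge.isCell.eq_or hc.mem₃ with e2 | e2 | e2
          exacts [absurd e2.symm hc.ne', absurd (e1.trans e2.symm) hc.rot.ne, e2]
        rw [e1, e2] at hxy
        exact h.eq_add_sub hs hxy hq.1 hqi hqu hx hy
      · have e2 : d = a := by
          rcases h.bridge.isCell.eq_or hc.mem₃ with e2 | e2 | e2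
          exacts [absurd e2.symm hc.ne', e2, absurd (e1.trans e2.symm) hc.rot.ne]
        rw [e1, e2] at hxy
        exact h.eq_add_sub hs hxy.swap hq.1 hqi hqu hy hx
    exact (h.loop.star τ (hq' ▸ hq)).resolve_right h2
  obtain ⟨t, ht, c, d, x, y, hc, hxy, hx, hy⟩ := hL.exists_cone hs h₁.bridge.inner q
  rcases ht with rfl | rfl | rfl
  · simp [key h₁ hc hxy hx hy]
  · simp [key h₂ hc hxy hx hy]
  · simp [key h₃ hc hxy hx hy]

end IsPendant

theorem IsSmooth.encard_neighborSet_le (hs : p.IsSmooth) (τ : p.curveGraph.coreSet) :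
    (p.curveGraph.core.neighborSet τ).encard ≤ 3 := by
  obtain ⟨a, b, c, h⟩ := hs.exists_isCell τ.1
  have hone : ∀ {a b c : ℤ × ℤ}, p.IsCell τ.1 a b c → (p.curveGraph.core.neighborSet τ ∩
      {σ | a ∈ p.cell σ.1 ∧ b ∈ p.cell σ.1}).encard ≤ 1 := by
    intro a b c h
    rw [Set.encard_le_one_iff]
    rintro σ σ' ⟨hσ, ha, hb⟩ ⟨hσ', ha', hb'⟩
    rw [SimpleGraph.mem_neighborSet] at hσ hσ'
    exact Subtype.ext (h.nbr_unique hs ha hb (fun e => hσ.ne (Subtype.ext e.symm)) ha' hb'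
      (fun e => hσ'.ne (Subtype.ext e.symm)))
  have hsub : p.curveGraph.core.neighborSet τ ⊆
      (p.curveGraph.core.neighborSet τ ∩ {σ | a ∈ p.cell σ.1 ∧ b ∈ p.cell σ.1}) ∪
      (p.curveGraph.core.neighborSet τ ∩ {σ | a ∈ p.cell σ.1 ∧ c ∈ p.cell σ.1}) ∪
      (p.curveGraph.core.neighborSet τ ∩ {σ | b ∈ p.cell σ.1 ∧ c ∈ p.cell σ.1}) := by
    intro σ hσ
    rcases h.adj_cases (t' := σ.1) hσ with h1 | h1 | h1
    exacts [Or.inl (Or.inl ⟨hσ, h1⟩), Or.inl (Or.inr ⟨hσ, h1⟩), Or.inr ⟨hσ, h1⟩]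
  calc _ ≤ _ := Set.encard_le_encard hsub
    _ ≤ _ := Set.encard_union_le _ _
    _ ≤ 1 + 1 + 1 := add_le_add ((Set.encard_union_le _ _).trans
        (add_le_add (hone h) (hone h.swap))) (hone h.rot)
    _ = 3 := by norm_num

end TropicalPoly

/-! ### Counting edges of a smoothing -/

namespace Graph

variable {V E T : Type*} {G : Graph V E}

/-- If `H` has maximal degree at most `3`, then a smoothing of `H` has at most `3 / 2` as many edges
as vertices. -/
theorem two_mul_ncard_edgeSet_le [Finite T] {H : SimpleGraph T} (hG : G.IsSmoothingOf H)
    (hH : ∀ t, (H.neighborSet t).encard ≤ 3) :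
    2 * G.edgeSet.ncard ≤ 3 * G.vertexSet.ncard := by
  classical
  obtain ⟨φ, γ, h1, h2⟩ := hG
  have hex : ∀ e : G.edgeSet, ∃ (x y : G.vertexSet) (σ σ' : T), H.Adj (φ x).1 σ ∧
      H.Adj (φ y).1 σ' ∧ s((φ x).1, σ) ∈ γ e ∧ s((φ y).1, σ') ∈ γ e ∧ ¬ (x = y ∧ σ = σ') := by
    intro e
    obtain ⟨x, y, hxy⟩ := exists_isLink_of_mem_edgeSet e.2
    obtain ⟨P, hP, hnil, -, hγ⟩ := h1 e ⟨x, hxy.left_mem⟩ ⟨y, hxy.right_mem⟩ hxy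
    obtain ⟨σ, σ', hσ, hσ', hne⟩ := hP.exists_end_darts hnil
    refine ⟨_, _, σ, σ', P.adj_of_mem_edges hσ, P.adj_of_mem_edges hσ', by rw [hγ]; exact hσ,
      by rw [hγ]; exact hσ', fun h => hne ⟨by rw [h.1], h.2⟩⟩
  choose x y σ σ' hσ hσ' hγ hγ' hne using hex
  have : Finite G.vertexSet := Finite.of_injective _ φ.injective
  have := Fintype.ofFinite G.vertexSet
  -- Each edge of `G` has two ends, sent injectively to directed edges of `H` leaving the vertices
  -- of `G`; at most three leave each vertex.
  let D : Type _ := Σ x : G.vertexSet, H.neighborSet (φ x).1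
  let f : G.edgeSet × Bool → D := fun e =>
    if e.2 then ⟨x e.1, σ e.1, hσ e.1⟩ else ⟨y e.1, σ' e.1, hσ' e.1⟩
  have hfmem : ∀ e, s((φ (f e).1).1, (f e).2.1) ∈ γ e.1 := by
    rintro ⟨e, _ | _⟩
    exacts [hγ' e, hγ e]
  have hf : Function.Injective f := by
    rintro ⟨e, i⟩ ⟨e', i'⟩ hee
    obtain rfl : e = e' := by
      refine (h2 s((φ (f (e, i)).1).1, (f (e, i)).2.1) (f (e, i)).2.2).unique (hfmem (e, i)) ?_
      rw [hee]
      exact hfmem (e', i')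
    have hD : ∀ d d' : D, d = d' → d.1 = d'.1 ∧ d.2.1 = d'.2.1 := by rintro d _ rfl; simp
    rcases i with _ | _ <;> rcases i' with _ | _
    · rfl
    · have := hD _ _ hee
      exact absurd ⟨this.1.symm, this.2.symm⟩ (hne e)
    · exact absurd (hD _ _ hee) (hne e)
    · rfl
  have hcard := Nat.card_le_card_of_injective f hf
  rw [Nat.card_prod, Nat.card_sigma, Nat.card_eq_fintype_card (α := Bool), Fintype.card_bool,
    Nat.card_coe_set_eq] at hcard
  have hsum : ∑ x : G.vertexSet, Nat.card (H.neighborSet (φ x).1) ≤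
      ∑ _x : G.vertexSet, 3 := by
    refine Finset.sum_le_sum fun x _ => ?_
    rw [Nat.card_coe_set_eq]
    have h3 := hH (φ x).1
    rw [← (Set.toFinite _).cast_ncard_eq] at h3
    exact_mod_cast h3
  rw [Finset.sum_const, Finset.card_univ, ← Nat.card_eq_fintype_card, Nat.card_coe_set_eq,
    smul_eq_mul] at hsum
  omega

end Graph

/-! ### The theorem -/

/-- A troplanar graph of genus at least `5` does not have three vertices forming a path, each of
which is incident to an edge that leads to a loop. -/
theorem corollary3p5 {V E : Type*} (G : Graph V E) (hG : G.IsTroplanar) (hg : 5 ≤ G.genus) :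
    ¬ ∃ v₁ v₂ v₃ : V, v₁ ≠ v₂ ∧ v₂ ≠ v₃ ∧ v₁ ≠ v₃ ∧ G.Adj v₁ v₂ ∧ G.Adj v₂ v₃ ∧
      G.HasPendantLoop v₁ ∧ G.HasPendantLoop v₂ ∧ G.HasPendantLoop v₃ := by
  rintro ⟨v₁, v₂, v₃, h₁₂, h₂₃, h₁₃, hadj₁₂, hadj₂₃, hl₁, hl₂, hl₃⟩
  obtain ⟨p, hs, hgenus, hsmooth⟩ := hG
  have hinner : ∃ u, p.IsInner u := by
    by_contra! hcon
    have : {u : ℤ × ℤ | ((u.1 : ℝ), (u.2 : ℝ)) ∈ interior p.newtonPolygon} = ∅ :=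
      Set.eq_empty_of_forall_notMem hcon
    rw [TropicalPoly.polygonGenus, this] at hgenus
    simp at hgenus
  have hedges := Graph.two_mul_ncard_edgeSet_le hsmooth hs.encard_neighborSet_le
  obtain ⟨φ, γ, h1, h2⟩ := hsmooth
  have hpend : ∀ {v : V} (hv : v ∈ G.vertexSet), G.HasPendantLoop v →
      ∃ (σ : G.vertexSet) (u a b : ℤ × ℤ),
        TropicalPoly.IsPendant (φ ⟨v, hv⟩).1 (φ σ).1 u a b := by
    rintro v hv ⟨w, e, l, hwv, he, hl⟩
    obtain ⟨P, hP, hnil, hP2, hγl⟩ := h1 ⟨l, hl.edge_mem⟩ ⟨w, hl.vertex_mem⟩ ⟨w, hl.vertex_mem⟩ hl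
    obtain ⟨s, a, b, hloop, hedge⟩ := TropicalPoly.exists_isLoopCell hs hinner hP hnil hP2
    obtain ⟨Q, -, hQnil, hQ2, hγe⟩ := h1 ⟨e, he.edge_mem⟩ ⟨w, hl.vertex_mem⟩ ⟨v, hv⟩ he.symm
    refine ⟨_, _, _, _, hloop.isPendant hs hQnil hQ2 fun ρ hadj hρ hmem => hwv ?_⟩
    -- A common edge of the two chains would identify `e` with the loop `l`, forcing `w = v`.
    have hel := (h2 _ hadj).unique (y₁ := ⟨e, he.edge_mem⟩) (y₂ := ⟨l, hl.edge_mem⟩)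
      (by rw [hγe]; exact hmem) (by rw [hγl]; exact hedge ρ hadj hρ)
    obtain rfl : e = l := congrArg Subtype.val hel
    exact (hl.eq_of_inc he.inc_left)
  have hne : ∀ {v w : V} (hv : v ∈ G.vertexSet) (hw : w ∈ G.vertexSet), v ≠ w →
      (φ ⟨v, hv⟩).1 ≠ (φ ⟨w, hw⟩).1 := fun hv hw hvw e =>
    hvw (congrArg Subtype.val (φ.injective (Subtype.ext e)))
  obtain ⟨σ₁, u₁, a₁, b₁, k₁⟩ := hpend hadj₁₂.left_mem hl₁
  obtain ⟨σ₂, u₂, a₂, b₂, k₂⟩ := hpend hadj₁₂.right_mem hl₂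
  obtain ⟨σ₃, u₃, a₃, b₃, k₃⟩ := hpend hadj₂₃.right_mem hl₃
  have hnbr : ∀ {v : V} (hv : v ∈ G.vertexSet), G.Adj v₂ v →
      u₂ ∈ p.cell (φ ⟨v, hv⟩).1.1 ∨ (φ ⟨v, hv⟩).1 = (φ σ₂).1 := by
    rintro v hv ⟨e, he⟩
    obtain ⟨P, -, hnil, hP2, -⟩ := h1 ⟨e, he.edge_mem⟩ ⟨v₂, hadj₁₂.right_mem⟩ ⟨v, hv⟩ he
    exact k₂.mem_or_eq hs (φ σ₂).2 hnil hP2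
  have n₁ := hnbr hadj₁₂.left_mem hadj₁₂.symm
  have n₃ := hnbr hadj₂₃.right_mem hadj₂₃
  obtain rfl := k₁.center_eq k₂ hs n₁ n₃ (φ _).2 (hne _ _ h₁₃.symm) (hne _ _ h₂₃.symm)
  obtain rfl := k₃.center_eq k₂ hs n₃ n₁ (φ _).2 (hne _ _ h₁₃) (hne _ _ h₁₂)
  have hsub : (fun x => (φ x).1) '' Set.univ ⊆
      ({(φ ⟨v₁, hadj₁₂.left_mem⟩).1, (φ ⟨v₂, hadj₁₂.right_mem⟩).1, (φ ⟨v₃, hadj₂₃.right_mem⟩).1,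
        (φ σ₁).1, (φ σ₂).1, (φ σ₃).1} : Set p.curveGraph.coreSet) := by
    rintro _ ⟨x, -, rfl⟩
    exact k₁.eq_of_encard_ne_two k₂ k₃ hs (hne _ _ h₁₂) (hne _ _ h₁₃) (hne _ _ h₂₃) (φ x).2
  have hcard : G.vertexSet.ncard ≤ 6 := by
    have hle := Set.ncard_le_ncard hsub
    rw [Set.ncard_image_of_injective _ fun x y h => φ.injective (Subtype.ext h),
      Set.ncard_univ, Nat.card_coe_set_eq] at hle
    refine hle.trans ?_
    refine (Set.ncard_insert_le _ _).trans (Nat.succ_le_succ ?_)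
    refine (Set.ncard_insert_le _ _).trans (Nat.succ_le_succ ?_)
    refine (Set.ncard_insert_le _ _).trans (Nat.succ_le_succ ?_)
    refine (Set.ncard_insert_le _ _).trans (Nat.succ_le_succ ?_)
    refine (Set.ncard_insert_le _ _).trans (Nat.succ_le_succ ?_)
    exact (Set.ncard_singleton _).le
  rw [Graph.genus] at hg
  omega
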